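/- Let $L/F$ be a finite unramified Galois extension of nonarchimedean local fields, $\Gamma=\mathrm{Gal}(L/F)$, $d=[L:F]$, let $\mathfrak f$ and $\mathfrak l$ be the residue fields of $F$ and $L$, $p$ the characteristic and $q$ the cardinality of $\mathfrak f$ (so $|\mathfrak l|=q^d$), and let $\gamma$ be the generator of $\Gamma$ that acts on $\mathfrak l$ by $x\mapsto x^q$. Fix a uniformizer $\varpi$ of $F$ and a generator of the cyclic group $\mathfrak l^\times$ with Teichmüller lift $\vartheta_L\in\mathcal O_L^\times$. Let $\mathbf T$ be a torus over $F$ that splits over $L$, with cocharacter lattice $Y$; identify $T_L=\mathbf T(L)=Y\otimes_{\mathbb Z}L^\times$ and $T_F=\mathbf T(F)=(Y\otimes_{\mathbb Z} L^\times)^\Gamma$, write $y(u)=y\otimes u$ for $y\in Y$, $u\in L^\times$, and let $T_F^1$ be the kernel of the reduction map $(Y\otimes\mathcal O_L^\times)^\Gamma\to(Y\otimes\mathfrak l^\times)^\Gamma$. Let $\bar Y=Y/(q^d-1)Y$; since $\vartheta_L^{q^d-1}=1$, the element $\bar y(\vartheta_L)\in T_L$ makes sense for $\bar y\in\bar Y$.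 Put $\delta_q=q\gamma-1\in\mathbb Z[\Gamma]$. Let $\mathbf T'$ be a central extension of $\mathbf T$ by $\mathbf K_2$ in the category of sheaves of groups on the big Zariski site of schemes of finite type over $F$, and let $Q\colon Y\to\mathbb Z$ be its $\Gamma$-invariant quadratic form in the sense of Brylinski and Deligne: over $L$, the extension $\mathbf T'$ is isomorphic to the one defined by the cocycle $(y_1(a),y_2(b))\mapsto\{a,b\}^{D(y_1,y_2)}$ for a bilinear form $D$ on $Y$ with $D(y,y)=Q(y)$. Let $B(y,y')=Q(y+y')-Q(y)-Q(y')$. Let $n\ge 1$ be prime to $p$ and such that $F$ contains $n$ distinct $n$-th roots of unity (so that $n\mid q-1$), and let $$1\to\mu_n(F)\to\tilde T_F\to T_F\to 1$$ be the tame cover, i.e. the push-forward of $1\to\mathbf K_2(F)\to\mathbf T'(F)\to T_F\to1$ along the tame symbol $\mathbf K_2(F)\to\mathfrak f^\times$ followed by the map $\mathfrak f^\times\to\mu_n(F)$ that takes the $\frac{q-1}{n}$-th power of the Teichmüller lift. Let $Z^\dagger(T_F)\subset T_F$ be the subgroup whose preimage in $\tilde T_F$ is the center of $\tilde T_F$.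 For a subgroup $W\subset Y$ let $W^\#=\{y\in Y: B(y,w)\in n\mathbb Z\text{ for all }w\in W\}$, let $Y^{\#\Gamma}=(Y^\#)^\Gamma$ and $Y^{\Gamma\#}=(Y^\Gamma)^\#$. Let $y_1\in Y$, $\bar y_2\in\bar Y$ and $t^1\in T_F^1$. Then $t=y_1(\varpi)\,\bar y_2(\vartheta_L)\,t^1\in T_L$ lies in $Z^\dagger(T_F)$ if and only if all of the following hold: 1. $y_1\in Y^{\#\Gamma}$; 2. $y_2\in Y^\#$ for every representative $y_2\in Y$ of $\bar y_2$; 3. $\delta_q y_2\in(q^d-1)Y^{\Gamma\#}$ for every representative $y_2\in Y$ of $\bar y_2$. Moreover, for each single representative $y_2\in Y$ of $\bar y_2$: $t\in Z^\dagger(T_F)$ if and only if $y_1\in Y^{\#\Gamma}$, $y_2\in Y^\#$ and $\delta_qy_2\in(q^d-1)Y^{\Gamma\#}$. -/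

import Mathlib

open CategoryTheory AlgebraicGeometry ValuativeRel Opposite
open scoped TensorProduct

universe u

namespace MetaplecticTorus

noncomputable section

/-! ### The big Zariski site of `F` -/

/-- Morphisms of finite type: locally of finite type and quasi-compact. -/
def finiteType : MorphismProperty Scheme.{u} :=
  fun _ _ f => LocallyOfFiniteType f ∧ QuasiCompact f

/-- The category of schemes of finite type over `F`. -/
abbrev FTSch (F : Type u) [Field F] : Type (u + 1) :=
  MorphismProperty.Over finiteType.{u} ⊤ (Spec (CommRingCat.of F))

/-- An affine open subscheme of `X`, as a scheme of finite type over `F`. -/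
def FTSch.ofAffineOpen {F : Type u} [Field F] (X : FTSch F) (U : Scheme.{u}) [IsAffine U]
    (j : U ⟶ X.left) [IsOpenImmersion j] : FTSch F :=
  MorphismProperty.Over.mk ⊤ (j ≫ X.hom) (by
    let g : X.left ⟶ Spec (CommRingCat.of F) := X.hom
    have h : LocallyOfFiniteType g := X.prop.1
    refine ⟨inferInstanceAs (LocallyOfFiniteType (j ≫ g)), ?_⟩
    change QuasiCompact (j ≫ g)
    rw [quasiCompact_iff_compactSpace]
    infer_instance)

/-- The Zariski topology: a sieve is covering when its open immersions are jointly surjective. -/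
def zariski (F : Type u) [Field F] : GrothendieckTopology (FTSch F) where
  sieves X := {S | ∀ x : X.left, ∃ (U : FTSch F) (j : U ⟶ X),
    S j ∧ IsOpenImmersion j.left ∧ x ∈ Set.range j.left}
  top_mem' X x := ⟨X, 𝟙 X, trivial, by
    change IsOpenImmersion (𝟙 X.left); infer_instance, ⟨x, rfl⟩⟩
  pullback_stable' := by
    intro X Y S f hS y
    obtain ⟨U, j, hj, hjo, u, hu⟩ := hS (f.left y)
    let V : Y.left.Opens := f.left ⁻¹ᵁ j.left.opensRange
    have hy : y ∈ V := ⟨u, hu⟩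
    obtain ⟨_, ⟨W, hW, rfl⟩, hyW, hWV⟩ := Y.left.isBasis_affineOpens.exists_subset_of_mem_open hy V.2
    let W : Y.left.Opens := W
    have hWa : IsAffine W := hW
    let g : (W : Scheme.{u}) ⟶ U.left :=
      IsOpenImmersion.lift j.left (W.ι ≫ f.left) (by
        rintro _ ⟨w, rfl⟩
        exact hWV w.2)
    have hg : g ≫ j.left = W.ι ≫ f.left := IsOpenImmersion.lift_fac _ _ _
    let i : Y.ofAffineOpen W W.ι ⟶ Y := MorphismProperty.Over.homMk W.ι rfl trivial
    let k : Y.ofAffineOpen W W.ι ⟶ U := MorphismProperty.Over.homMk g (by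
      change g ≫ U.hom = W.ι ≫ Y.hom
      rw [← MorphismProperty.Over.w j, ← MorphismProperty.Over.w f, reassoc_of% hg]) trivial
    refine ⟨_, i, ?_, ?_, ⟨y, hyW⟩, rfl⟩
    · have : i ≫ f = k ≫ j := by
        apply MorphismProperty.Over.Hom.ext
        exact hg.symm
      change S (i ≫ f)
      rw [this]
      exact S.downward_closed hj k
    · change IsOpenImmersion W.ι
      infer_instance
  transitive' := by
    intro X S hS R hR x
    obtain ⟨U, j, hj, hjo, u, hu⟩ := hS x
    obtain ⟨W, k, hk, hko, w, hw⟩ := hR hj u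
    refine ⟨W, k ≫ j, hk, ?_, w, ?_⟩
    · change IsOpenImmersion (k.left ≫ j.left); infer_instance
    · change (k.left ≫ j.left) w = x
      simp [hw, hu]

/-- The `F`-algebra of global functions on an `F`-scheme. -/
abbrev Fun {F : Type u} [Field F] (X : FTSch F) : Type u := Γ(X.left, ⊤)

instance {F : Type u} [Field F] (X : FTSch F) : Algebra F (Fun X) :=
  RingHom.toAlgebra (((Scheme.ΓSpecIso (CommRingCat.of F)).inv ≫
    Scheme.Hom.appTop (Y := Spec (CommRingCat.of F)) X.hom).hom)

/-- Pullback of global functions along a morphism of `F`-schemes. -/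
def Fun.pullback {F : Type u} [Field F] {X Y : FTSch F} (f : Y ⟶ X) : Fun X →ₐ[F] Fun Y where
  toRingHom := (Scheme.Hom.appTop f.left).hom
  commutes' a := by
    change (Scheme.Hom.appTop f.left).hom ((Scheme.Hom.appTop (Y := Spec (CommRingCat.of F)) X.hom).hom
        ((Scheme.ΓSpecIso (CommRingCat.of F)).inv.hom a)) =
      (Scheme.Hom.appTop (Y := Spec (CommRingCat.of F)) Y.hom).hom
        ((Scheme.ΓSpecIso (CommRingCat.of F)).inv.hom a)
    have h : f.left ≫ X.hom = Y.hom := MorphismProperty.Over.w f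
    rw [← h]
    rfl

lemma Fun.pullback_id {F : Type u} [Field F] (X : FTSch F) :
    Fun.pullback (𝟙 X) = AlgHom.id F (Fun X) := by
  ext a
  rfl

lemma Fun.pullback_comp {F : Type u} [Field F] {X Y Z : FTSch F} (g : Z ⟶ Y) (f : Y ⟶ X) :
    Fun.pullback (g ≫ f) = (Fun.pullback g).comp (Fun.pullback f) := by
  ext a
  change (Scheme.Hom.appTop (g.left ≫ f.left)).hom a = _
  rw [Scheme.Hom.comp_appTop]
  rfl

/-- The point `Spec F`. -/
def pt (F : Type u) [Field F] : FTSch F :=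
  MorphismProperty.Over.mk ⊤ (𝟙 (Spec (CommRingCat.of F)))
    ⟨inferInstanceAs (LocallyOfFiniteType (𝟙 (Spec (CommRingCat.of F)))),
      inferInstanceAs (QuasiCompact (𝟙 (Spec (CommRingCat.of F))))⟩

/-! ### The sheaf `K₂` -/

/-- The Steinberg relations `a ⊗ b` with `a + b = 1`. -/
def steinberg (A : Type u) [CommRing A] : Submodule ℤ (Additive Aˣ ⊗[ℤ] Additive Aˣ) :=
  Submodule.span ℤ {t | ∃ a b : Aˣ, (a : A) + b = 1 ∧ t = Additive.ofMul a ⊗ₜ Additive.ofMul b}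

/-- `A^× ⊗ A^×` modulo the Steinberg relations, written additively. -/
abbrev MilnorK2 (A : Type u) [CommRing A] : Type u :=
  (Additive Aˣ ⊗[ℤ] Additive Aˣ) ⧸ steinberg A

/-- The universal symbol `{a, b}`, as a bilinear map. -/
def symb (A : Type u) [CommRing A] : Additive Aˣ →ₗ[ℤ] Additive Aˣ →ₗ[ℤ] MilnorK2 A :=
  (TensorProduct.mk ℤ (Additive Aˣ) (Additive Aˣ)).compr₂ (steinberg A).mkQ

/-- A ring homomorphism on units, written additively. -/
def unitsMap {A B : Type u} [CommRing A] [CommRing B] (f : A →+* B) :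
    Additive Aˣ →ₗ[ℤ] Additive Bˣ :=
  (Units.map (f : A →* B)).toAdditive.toIntLinearMap

/-- Functoriality of `MilnorK2`. -/
def MilnorK2.map {A B : Type u} [CommRing A] [CommRing B] (f : A →+* B) :
    MilnorK2 A →ₗ[ℤ] MilnorK2 B :=
  Submodule.mapQ _ _ (TensorProduct.map (unitsMap f) (unitsMap f)) (by
    rw [steinberg, Submodule.span_le]
    rintro _ ⟨a, b, h, rfl⟩
    refine Submodule.subset_span ⟨Units.map (f : A →* B) a, Units.map (f : A →* B) b, ?_, rfl⟩
    simp [← map_add, h])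

lemma MilnorK2.map_symb {A B : Type u} [CommRing A] [CommRing B] (f : A →+* B) (a b : Aˣ) :
    MilnorK2.map f (symb A (Additive.ofMul a) (Additive.ofMul b)) =
      symb B (Additive.ofMul (Units.map (f : A →* B) a))
        (Additive.ofMul (Units.map (f : A →* B) b)) := rfl

lemma MilnorK2.hom_ext {A : Type u} [CommRing A] {M : Type*} [AddCommGroup M]
    {f g : MilnorK2 A →ₗ[ℤ] M} (h : ∀ a b, f (symb A a b) = g (symb A a b)) : f = g := by
  apply Submodule.linearMap_qext
  apply TensorProduct.ext'
  exact h

/-- The presheaf `X ↦ MilnorK2 Γ(X, 𝒪)` on the big Zariski site. -/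
def milnorPresheaf (F : Type u) [Field F] : (FTSch F)ᵒᵖ ⥤ AddCommGrpCat.{u + 1} where
  obj X := AddCommGrpCat.of (ULift.{u + 1} (MilnorK2 (Fun X.unop)))
  map f := AddCommGrpCat.ofHom
    (AddEquiv.ulift.symm.toAddMonoidHom.comp
      ((MilnorK2.map (Fun.pullback f.unop).toRingHom).toAddMonoidHom.comp
        AddEquiv.ulift.toAddMonoidHom))
  map_id X := by
    have : MilnorK2.map (Fun.pullback (𝟙 X.unop)).toRingHom = LinearMap.id := by
      apply MilnorK2.hom_ext
      intro a b
      rfl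
    ext ⟨x⟩
    exact DFunLike.congr_fun this x
  map_comp {X Y Z} f g := by
    have : MilnorK2.map (Fun.pullback (g.unop ≫ f.unop)).toRingHom =
        (MilnorK2.map (Fun.pullback g.unop).toRingHom).comp
          (MilnorK2.map (Fun.pullback f.unop).toRingHom) := by
      apply MilnorK2.hom_ext
      intro a b
      rw [Fun.pullback_comp]
      rfl
    ext ⟨x⟩
    exact DFunLike.congr_fun this x

/-- The Zariski sheaf `K₂` on `F_Zar`.  For a local ring `A` with infinite residue field, `K₂(A)`
is the quotient of `A^× ⊗ A^×` by the Steinberg relations; since `F` is infinite, Quillen's sheaf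
is the sheaf associated with `milnorPresheaf`. -/
def K2 (F : Type u) [Field F] : Sheaf (zariski F) AddCommGrpCat.{u + 1} :=
  (presheafToSheaf (zariski F) AddCommGrpCat.{u + 1}).obj (milnorPresheaf F)

/-- A symbol over `Γ(X, 𝒪)`, as a section of the sheaf `K₂`. -/
def toK2 {F : Type u} [Field F] (X : FTSch F) : MilnorK2 (Fun X) →+ (K2 F).obj.obj (op X) :=
  ((toSheafify (zariski F) (milnorPresheaf F)).app (op X)).hom.comp
    AddEquiv.ulift.symm.toAddMonoidHom

/-! ### Tori -/

section Torus

variable {Y : Type u} [AddCommGroup Y]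

/-- The map `Y ⊗ A^× → Y ⊗ B^×` induced by an endomorphism of `Y` and a ring homomorphism. -/
def cocharMap {A B : Type u} [CommRing A] [CommRing B] (g : Y →+ Y) (f : A →+* B) :
    Y ⊗[ℤ] Additive Aˣ →ₗ[ℤ] Y ⊗[ℤ] Additive Bˣ :=
  TensorProduct.map g.toIntLinearMap (unitsMap f)

lemma cocharMap_comm {A B B' C : Type u} [CommRing A] [CommRing B] [CommRing B'] [CommRing C]
    (g : Y →+ Y) (f : A →+* B) (f' : B →+* C) (h : A →+* B') (h' : B' →+* C)
    (H : ∀ x, f' (f x) = h' (h x)) (t : Y ⊗[ℤ] Additive Aˣ) :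
    cocharMap g f' (cocharMap (AddMonoidHom.id Y) f t) =
      cocharMap (AddMonoidHom.id Y) h' (cocharMap g h t) := by
  have : (cocharMap g f').comp (cocharMap (AddMonoidHom.id Y) f) =
      (cocharMap (AddMonoidHom.id Y) h').comp (cocharMap g h) := by
    refine TensorProduct.ext' fun y a => ?_
    refine congrArg (fun b : Cˣ => g y ⊗ₜ[ℤ] Additive.ofMul b) (Units.ext ?_)
    exact H _
  exact DFunLike.congr_fun this t

variable (F : Type u) [Field F] (L : Type u) [Field L] [Algebra F L]
  (Y) [DistribMulAction (L ≃ₐ[F] L) Y]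

/-- The `R`-points `(Y ⊗ (R ⊗_F L)^×)^Γ` of the torus over `F` with splitting field `L`,
`Γ = Gal(L/F)`, and cocharacter lattice `Y`. -/
def torus (R : Type u) [CommRing R] [Algebra F R] :
    AddSubgroup (Y ⊗[ℤ] Additive (R ⊗[F] L)ˣ) where
  carrier := {t | ∀ σ : L ≃ₐ[F] L, cocharMap (DistribSMul.toAddMonoidHom Y σ)
    (Algebra.TensorProduct.map (AlgHom.id F R) (σ : L →ₐ[F] L)).toRingHom t = t}
  zero_mem' σ := map_zero _
  add_mem' hs ht σ := by rw [map_add, hs σ, ht σ]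
  neg_mem' ht σ := by rw [map_neg, ht σ]

variable {F} in
/-- Functoriality of the points of the torus. -/
def torusPull {R S : Type u} [CommRing R] [Algebra F R] [CommRing S] [Algebra F S]
    (f : R →ₐ[F] S) : torus Y F L R →+ torus Y F L S :=
  ((cocharMap (AddMonoidHom.id Y)
      (Algebra.TensorProduct.map f (AlgHom.id F L)).toRingHom).toAddMonoidHom.comp
    (torus Y F L R).subtype).codRestrict _ (by
      rintro ⟨t, ht⟩ σ
      change cocharMap _ _ (cocharMap _ _ t) = cocharMap _ _ t
      refine (cocharMap_comm _ _ _ _ _ ?_ t).trans (congrArg _ (ht σ))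
      have h : (Algebra.TensorProduct.map (AlgHom.id F S) (σ : L →ₐ[F] L)).comp
            (Algebra.TensorProduct.map f (AlgHom.id F L)) =
          (Algebra.TensorProduct.map f (AlgHom.id F L)).comp
            (Algebra.TensorProduct.map (AlgHom.id F R) (σ : L →ₐ[F] L)) := by
        ext <;> simp
      exact DFunLike.congr_fun h)

/-- The group `T(L) = Y ⊗ L^×`. -/
abbrev TL : Type u := Y ⊗[ℤ] Additive Lˣ

/-- The group `T(F) = (Y ⊗ L^×)^Γ`. -/
def TF : AddSubgroup (TL Y L) where
  carrier := {t | ∀ σ : L ≃ₐ[F] L,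
    cocharMap (DistribSMul.toAddMonoidHom Y σ) (σ : L →ₐ[F] L).toRingHom t = t}
  zero_mem' σ := map_zero _
  add_mem' hs ht σ := by rw [map_add, hs σ, ht σ]
  neg_mem' ht σ := by rw [map_neg, ht σ]

/-- The structural map `T(F) → T(R)`; it is an isomorphism when `F → R` is. -/
def torusBase (R : Type u) [CommRing R] [Algebra F R] : TF Y F L →+ torus Y F L R :=
  ((cocharMap (AddMonoidHom.id Y)
      (Algebra.TensorProduct.includeRight : L →ₐ[F] R ⊗[F] L).toRingHom).toAddMonoidHom.comp
    (TF Y F L).subtype).codRestrict _ (by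
      rintro ⟨t, ht⟩ σ
      change cocharMap _ _ (cocharMap _ _ t) = cocharMap _ _ t
      refine (cocharMap_comm _ _ _ _ _ ?_ t).trans (congrArg _ (ht σ))
      intro x
      simp)

variable {F L} in
/-- Over an `L`-algebra `R` the torus splits: the isomorphism `T(R) ≅ Y ⊗ R^×` induced by
`R ⊗_F L → R`, `r ⊗ l ↦ r φ(l)`, where `φ : L → R` is the structure map. -/
def torusSplit {R : Type u} [CommRing R] [Algebra F R] (φ : L →ₐ[F] R) :
    torus Y F L R →+ Y ⊗[ℤ] Additive Rˣ :=
  (cocharMap (AddMonoidHom.id Y)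
      (Algebra.TensorProduct.productMap (AlgHom.id F R) φ).toRingHom).toAddMonoidHom.comp
    (torus Y F L R).subtype

/-! ### Central extensions of the torus by `K₂`, and their quadratic forms -/

/-- A central extension `1 → K₂ → T' → T → 1` of Zariski sheaves of groups on `F_Zar`, where
`T` is the torus with splitting field `L` and cocharacter lattice `Y`.  (`T` is affine, so
`T(X) = T(Γ(X, 𝒪))`.) -/
structure CentralExtension where
  /-- the sheaf of groups `T'` -/
  E : Sheaf (zariski F) GrpCat.{u + 1}
  /-- the inclusion of `K₂` -/
  i : ∀ X : FTSch F, Multiplicative ((K2 F).obj.obj (op X)) →* E.obj.obj (op X)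
  /-- the projection to `T` -/
  π : ∀ X : FTSch F, E.obj.obj (op X) →* Multiplicative (torus Y F L (Fun X))
  i_natural : ∀ {X X' : FTSch F} (f : X' ⟶ X) (k : (K2 F).obj.obj (op X)),
    E.obj.map f.op (i X (.ofAdd k)) = i X' (.ofAdd ((K2 F).obj.map f.op k))
  π_natural : ∀ {X X' : FTSch F} (f : X' ⟶ X) (e : E.obj.obj (op X)),
    π X' (E.obj.map f.op e) = .ofAdd (torusPull Y L (Fun.pullback f) (π X e).toAdd)
  i_injective : ∀ X, Function.Injective (i X)
  range_i : ∀ X, (i X).range = (π X).ker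
  central : ∀ X, (i X).range ≤ Subgroup.center (E.obj.obj (op X))
  /-- the projection is an epimorphism of sheaves -/
  locally_surjective : ∀ (X : FTSch F) (t : torus Y F L (Fun X)),
    ∃ S ∈ zariski F X, ∀ (X' : FTSch F) (f : X' ⟶ X), S f →
      ∃ e, π X' e = .ofAdd (torusPull Y L (Fun.pullback f) t)

/-- The pairing `(y₁ ⊗ a, y₂ ⊗ b) ↦ D(y₁, y₂) {a, b}` attached to a bilinear form `D` on `Y`. -/
def symbolPairing {Y : Type u} [AddCommGroup Y] (D : LinearMap.BilinForm ℤ Y) (A : Type u)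
    [CommRing A] : Y ⊗[ℤ] Additive Aˣ →ₗ[ℤ] Y ⊗[ℤ] Additive Aˣ →ₗ[ℤ] MilnorK2 A :=
  (TensorProduct.map₂ D (symb A)).compr₂ (TensorProduct.lid ℤ (MilnorK2 A)).toLinearMap

variable {Y F L} in
/-- `Q` is the quadratic form of the central extension: `Q` is `Γ`-invariant, and over `L` the
extension is isomorphic, for a bilinear form `D` with `D(y, y) = Q(y)`, to the one with cocycle
`(y₁(a), y₂(b)) ↦ {a, b}^{D(y₁, y₂)}`; that is, on `L`-schemes, it has a section `s` (a morphism
of sheaves of sets) with this cocycle.  An `L`-scheme is an `F`-scheme `X` with an `F`-algebra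
homomorphism `φ : L → Γ(X, 𝒪)`. -/
def CentralExtension.HasQuadraticForm (T' : CentralExtension Y F L) (Q : QuadraticForm ℤ Y) :
    Prop :=
  (∀ (σ : L ≃ₐ[F] L) (y : Y), Q (σ • y) = Q y) ∧
  ∃ D : LinearMap.BilinForm ℤ Y, (∀ y, D y y = Q y) ∧
  ∃ s : ∀ X : FTSch F, (L →ₐ[F] Fun X) → torus Y F L (Fun X) → T'.E.obj.obj (op X),
    (∀ X φ t, T'.π X (s X φ t) = .ofAdd t) ∧
    (∀ (X X' : FTSch F) (f : X' ⟶ X) (φ : L →ₐ[F] Fun X) (t : torus Y F L (Fun X)),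
      T'.E.obj.map f.op (s X φ t) =
        s X' ((Fun.pullback f).comp φ) (torusPull Y L (Fun.pullback f) t)) ∧
    (∀ X φ t₁ t₂, s X φ t₁ * s X φ t₂ = s X φ (t₁ + t₂) *
      T'.i X (.ofAdd (toK2 X
        (symbolPairing D (Fun X) (torusSplit Y φ t₁) (torusSplit Y φ t₂)))))

end Torus

/-! ### Nonarchimedean local fields and the tame symbol -/

section LocalField

variable (F : Type u) [Field F] [ValuativeRel F] [TopologicalSpace F]
  [IsNonarchimedeanLocalField F]

/-- The normalized valuation `F^× → ℤ`. -/
def ord : Fˣ →* Multiplicative ℤ where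
  toFun x := .ofAdd (-WithZero.log
    (IsNonarchimedeanLocalField.valueGroupWithZeroIsoInt F (valuation F (x : F))))
  map_one' := by simp
  map_mul' x y := by
    have h (x : Fˣ) : IsNonarchimedeanLocalField.valueGroupWithZeroIsoInt F
        (valuation F (x : F)) ≠ 0 := by simp
    simp only [Units.val_mul, map_mul, WithZero.log_mul (h x) (h y), neg_add, ofAdd_add]

variable {F}

lemma ord_nonneg_iff (x : Fˣ) : 0 ≤ (ord F x).toAdd ↔ valuation F (x : F) ≤ 1 := by
  have h : IsNonarchimedeanLocalField.valueGroupWithZeroIsoInt F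
      (valuation F (x : F)) ≠ 0 := by simp
  have e : (ord F x).toAdd = -WithZero.log
    (IsNonarchimedeanLocalField.valueGroupWithZeroIsoInt F (valuation F (x : F))) := rfl
  rw [e, neg_nonneg, ← WithZero.log_one, WithZero.log_le_log h one_ne_zero,
    ← map_one (IsNonarchimedeanLocalField.valueGroupWithZeroIsoInt F),
    map_le_map_iff]

lemma ord_pos_iff (x : Fˣ) : 0 < (ord F x).toAdd ↔ valuation F (x : F) < 1 := by
  have h : IsNonarchimedeanLocalField.valueGroupWithZeroIsoInt F
      (valuation F (x : F)) ≠ 0 := by simp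
  have e : (ord F x).toAdd = -WithZero.log
    (IsNonarchimedeanLocalField.valueGroupWithZeroIsoInt F (valuation F (x : F))) := rfl
  rw [e, neg_pos, ← WithZero.log_one, WithZero.log_lt_log h one_ne_zero,
    ← map_one (IsNonarchimedeanLocalField.valueGroupWithZeroIsoInt F),
    map_lt_map_iff]

lemma valuation_eq_one {x : Fˣ} (h : x ∈ (ord F).ker) : valuation F (x : F) = 1 := by
  have h0 : (ord F x).toAdd = 0 := h
  refine le_antisymm ((ord_nonneg_iff x).1 h0.ge) ?_
  by_contra h1
  have := (ord_pos_iff x).2 (not_le.1 h1)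
  omega

variable (F) in
/-- Elements of valuation `0`, as units of the ring of integers. -/
def intUnit : (ord F).ker →* 𝒪[F]ˣ where
  toFun x :=
    { val := ⟨(x : Fˣ), (valuation_eq_one x.2).le⟩
      inv := ⟨((x⁻¹ : (ord F).ker) : Fˣ), (valuation_eq_one (x⁻¹).2).le⟩
      val_inv := Subtype.ext (by simp)
      inv_val := Subtype.ext (by simp) }
  map_one' := rfl
  map_mul' _ _ := rfl

variable (F) in
/-- The reduction map on units. -/
def redUnit : 𝒪[F]ˣ →* 𝓀[F]ˣ := Units.map (IsLocalRing.residue 𝒪[F] : 𝒪[F] →* 𝓀[F])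

lemma eq_one_of_pow_eq_one {u : 𝒪[F]} {n : ℕ} (hu : u ^ n = 1)
    (h : IsLocalRing.residue 𝒪[F] u = 1) (hn : (n : 𝓀[F]) ≠ 0) : u = 1 := by
  have h1 : (u - 1) * ∑ i ∈ Finset.range n, u ^ i = 0 := by rw [mul_geom_sum, hu, sub_self]
  rcases mul_eq_zero.1 h1 with h2 | h2
  · exact sub_eq_zero.1 h2
  · exfalso
    apply hn
    have := congrArg (IsLocalRing.residue 𝒪[F]) h2
    simpa [map_sum, h] using this

lemma card_sub_one_ne_zero : ((Nat.card 𝓀[F] - 1 : ℕ) : 𝓀[F]) ≠ 0 := by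
  have := Fintype.ofFinite 𝓀[F]
  rw [Nat.cast_sub Nat.card_pos, Nat.card_eq_fintype_card, Nat.cast_card_eq_zero]
  simp

lemma pow_card_sub_one (x : 𝓀[F]ˣ) : x ^ (Nat.card 𝓀[F] - 1) = 1 := by
  have := Fintype.ofFinite 𝓀[F]
  rw [Nat.card_eq_fintype_card]
  exact Units.ext (by simpa using FiniteField.pow_card_sub_one_eq_one (x : 𝓀[F]) x.ne_zero)

lemma exists_teichmuller (x : 𝓀[F]ˣ) :
    ∃ u : 𝒪[F]ˣ, u ^ (Nat.card 𝓀[F] - 1) = 1 ∧ redUnit F u = x := by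
  let := IsTopologicalAddGroup.rightUniformSpace F
  have := isUniformAddGroup_of_addCommGroup (G := F)
  have hH : HenselianRing 𝒪[F] 𝓂[F] := inferInstance
  set N := Nat.card 𝓀[F] - 1 with hN
  have hN0 : N ≠ 0 := by
    have : 1 < Nat.card 𝓀[F] := Finite.one_lt_card
    omega
  obtain ⟨a₀, ha₀⟩ := IsLocalRing.residue_surjective (R := 𝒪[F]) (x : 𝓀[F])
  obtain ⟨a, ha, haa⟩ := hH.is_henselian (Polynomial.X ^ N - 1)
    (Polynomial.monic_X_pow_sub_C 1 hN0) a₀ (by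
      rw [← IsLocalRing.residue_eq_zero_iff]
      simp only [Polynomial.eval_sub, Polynomial.eval_pow, Polynomial.eval_X,
        Polynomial.eval_one, map_sub, map_pow, map_one, ha₀]
      rw [← Units.val_pow_eq_pow_val, pow_card_sub_one, Units.val_one, sub_self]) (by
      change IsUnit (IsLocalRing.residue 𝒪[F] _)
      simp only [Polynomial.derivative_sub, Polynomial.derivative_X_pow,
        Polynomial.derivative_one, sub_zero, Polynomial.eval_mul, Polynomial.eval_pow,
        Polynomial.eval_X, map_mul, map_pow, ha₀]
      refine IsUnit.mul ?_ (x.isUnit.pow _)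
      rw [Polynomial.eval_C, map_natCast]
      exact (card_sub_one_ne_zero (F := F)).isUnit)
  have haN : a ^ N = 1 := by
    simpa [Polynomial.IsRoot, sub_eq_zero] using ha
  have hres : IsLocalRing.residue 𝒪[F] a = x := by
    rw [← ha₀, ← sub_eq_zero, ← map_sub, IsLocalRing.residue_eq_zero_iff]
    exact haa
  refine ⟨Units.ofPowEqOne a N haN hN0, Units.ext ?_, Units.ext hres⟩
  simp

lemma teichmuller_unique {u w : 𝒪[F]ˣ} (hu : u ^ (Nat.card 𝓀[F] - 1) = 1)
    (hw : w ^ (Nat.card 𝓀[F] - 1) = 1) (h : redUnit F u = redUnit F w) : u = w := by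
  rw [← div_eq_one]
  have h1 : (u / w) ^ (Nat.card 𝓀[F] - 1) = 1 := by rw [div_pow, hu, hw, div_one]
  have h2 : redUnit F (u / w) = 1 := by rw [map_div, h, div_self']
  exact Units.ext (eq_one_of_pow_eq_one (by simpa using congrArg Units.val h1)
    (congrArg Units.val h2) card_sub_one_ne_zero)

variable (F) in
/-- The Teichmüller lifting: `x` is sent to the root of unity of order prime to the residue
characteristic that lifts it. -/
def teichmuller : 𝓀[F]ˣ →* 𝒪[F]ˣ where
  toFun x := (exists_teichmuller x).choose
  map_one' := teichmuller_unique (exists_teichmuller 1).choose_spec.1 (one_pow _)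
    ((exists_teichmuller 1).choose_spec.2.trans (map_one _).symm)
  map_mul' x y := by
    refine teichmuller_unique (exists_teichmuller (x * y)).choose_spec.1 ?_ ?_
    · rw [mul_pow, (exists_teichmuller x).choose_spec.1, (exists_teichmuller y).choose_spec.1,
        one_mul]
    · rw [(exists_teichmuller (x * y)).choose_spec.2, map_mul,
        (exists_teichmuller x).choose_spec.2, (exists_teichmuller y).choose_spec.2]

lemma redUnit_teichmuller (x : 𝓀[F]ˣ) : redUnit F (teichmuller F x) = x :=
  (exists_teichmuller x).choose_spec.2

variable (F) in
/-- The inclusion `𝒪_F^× → F^×`. -/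
def inclUnit : 𝒪[F]ˣ →* Fˣ := Units.map (𝒪[F].subtype : 𝒪[F] →* F)

lemma dvd_card_sub_one {n : ℕ} (hn : Nat.card (rootsOfUnity n F) = n) (hn0 : 0 < n)
    (hp : (ringChar 𝓀[F]).Coprime n) : n ∣ Nat.card 𝓀[F] - 1 := by
  have hle : rootsOfUnity n F ≤ (ord F).ker := by
    intro u hu
    have h1 : ord F u ^ n = 1 := by rw [← map_pow, (mem_rootsOfUnity n u).1 hu, map_one]
    have h2 : n • (ord F u).toAdd = 0 := h1
    have h3 : (ord F u).toAdd = 0 := by simpa [hn0.ne'] using h2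
    exact h3
  let f : rootsOfUnity n F →* 𝓀[F]ˣ :=
    (redUnit F).comp ((intUnit F).comp (Subgroup.inclusion hle))
  have hnk : (n : 𝓀[F]) ≠ 0 := by
    intro h
    have h1 := (ringChar.spec 𝓀[F] n).1 h
    have h2 : ringChar 𝓀[F] = 1 := Nat.eq_one_of_dvd_coprimes hp dvd_rfl h1
    exact CharP.ringChar_ne_one h2
  have hf : Function.Injective f := by
    rw [injective_iff_map_eq_one]
    intro u hu
    have h1 := eq_one_of_pow_eq_one
      (u := (intUnit F (Subgroup.inclusion hle u) : 𝒪[F])) (n := n)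
      (Subtype.ext (by
        have := congrArg Units.val ((mem_rootsOfUnity n (u : Fˣ)).1 u.2)
        simpa using! this)) (congrArg Units.val hu) hnk
    exact Subtype.ext (Units.ext (congrArg Subtype.val h1))
  have := Subgroup.card_dvd_of_injective f hf
  rwa [hn, Nat.card_units] at this

/-- The element `(-1)^{v(a)v(b)} a^{v(b)} b^{-v(a)}` of `F^×`. -/
def tameElt (a b : Fˣ) : Fˣ :=
  (-1) ^ ((ord F a).toAdd * (ord F b).toAdd) * a ^ (ord F b).toAdd * b ^ (-(ord F a).toAdd)

lemma ord_neg_one : ord F (-1) = 1 := by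
  have h : ord F (-1) ^ 2 = 1 := by rw [← map_pow]; simp
  have h2 : 2 • (ord F (-1)).toAdd = 0 := h
  have h3 : (ord F (-1)).toAdd = 0 := by simpa using h2
  exact h3

lemma tameElt_mem (a b : Fˣ) : tameElt a b ∈ (ord F).ker := by
  rw [MonoidHom.mem_ker, tameElt, map_mul, map_mul, map_zpow, map_zpow, map_zpow, ord_neg_one,
    one_zpow, one_mul]
  apply Multiplicative.toAdd.injective
  simp
  ring

lemma tameElt_mul_left (a a' b : Fˣ) : tameElt (a * a') b = tameElt a b * tameElt a' b := by
  simp only [tameElt, map_mul, toAdd_mul, add_mul, zpow_add, mul_zpow, neg_add]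
  exact Units.ext (by push_cast; ring)

lemma tameElt_mul_right (a b b' : Fˣ) : tameElt a (b * b') = tameElt a b * tameElt a b' := by
  simp only [tameElt, map_mul, toAdd_mul, mul_add, zpow_add, mul_zpow]
  exact Units.ext (by push_cast; ring)

variable (F) in
/-- Reduction of elements of valuation `0`. -/
def resUnit : (ord F).ker →* 𝓀[F]ˣ := (redUnit F).comp (intUnit F)

lemma resUnit_eq_one {x : (ord F).ker} (h : valuation F (((x : Fˣ) : F) - 1) < 1) :
    resUnit F x = 1 := by
  apply Units.ext
  change IsLocalRing.residue 𝒪[F] (intUnit F x : 𝒪[F]) = 1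
  rw [← sub_eq_zero, ← map_one (IsLocalRing.residue 𝒪[F]), ← map_sub,
    IsLocalRing.residue_eq_zero_iff, IsLocalRing.mem_maximalIdeal, mem_nonunits_iff,
    Valuation.Integer.not_isUnit_iff_valuation_lt_one]
  exact h

/-- The tame symbol of `a` and `b`: the class of `(-1)^{v(a)v(b)} a^{v(b)} b^{-v(a)}`. -/
def tameSymbol (a b : Fˣ) : 𝓀[F]ˣ := resUnit F ⟨tameElt a b, tameElt_mem a b⟩

lemma tameSymbol_steinberg {a b : Fˣ} (hab : (a : F) + b = 1) : tameSymbol a b = 1 := by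
  have hb : (b : F) - 1 = -a := by rw [← hab]; ring
  have ha : (a : F) - 1 = -b := by rw [← hab]; ring
  have key : ∀ (x : Fˣ) (k : ℤ), ord F x = 1 → valuation F ((x : F) - 1) < 1 →
      tameElt a b = x ^ k → tameSymbol a b = 1 := by
    intro x k hx hv he
    have h1 : (⟨tameElt a b, tameElt_mem a b⟩ : (ord F).ker) = ⟨x, hx⟩ ^ k := Subtype.ext he
    rw [tameSymbol, h1, map_zpow, resUnit_eq_one (x := ⟨x, hx⟩) hv, one_zpow]
  have hone : ∀ x : Fˣ, valuation F (x : F) = 1 → ord F x = 1 := by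
    intro x hx
    have h1 := (ord_nonneg_iff x).2 hx.le
    have h2 : ¬ 0 < (ord F x).toAdd := by
      rw [ord_pos_iff, hx]
      exact lt_irrefl _
    exact Multiplicative.toAdd.injective (by
      change (ord F x).toAdd = 0
      omega)
  rcases lt_trichotomy (ord F a).toAdd 0 with h | h | h
  · have hva : 1 < valuation F (a : F) := by
      rw [← not_le, ← ord_nonneg_iff]; omega
    have hva' := hva
    have hvb : valuation F (b : F) = valuation F (a : F) := by
      have : (b : F) = 1 - a := by rw [← hab]; ring
      rw [this]
      rw [← Valuation.map_one (valuation F)] at hva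
      exact Valuation.map_sub_eq_of_lt_right _ hva
    have hord : ord F b = ord F a := by
      have : ord F (b / a) = 1 := hone _ (by simp [hvb])
      rwa [map_div, div_eq_one] at this
    refine key (-(a / b)) (ord F a).toAdd (hone _ ?_) ?_ ?_
    · simp [hvb]
    · have : ((-(a / b) : Fˣ) : F) - 1 = -(b : F)⁻¹ := by
        have hb0 : (b : F) ≠ 0 := b.ne_zero
        push_cast
        field_simp
        rw [← hab]; ring
      rw [this, Valuation.map_neg, map_inv₀, hvb]
      exact inv_lt_one_of_one_lt₀ hva'
    · rw [tameElt, hord]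
      have h1 : (-1 : Fˣ) ^ ((ord F a).toAdd * (ord F a).toAdd) = (-1) ^ (ord F a).toAdd := by
        rcases Int.even_or_odd (ord F a).toAdd with he | ho
        · rw [(he.mul_left _).neg_one_zpow, he.neg_one_zpow]
        · rw [(ho.mul ho).neg_one_zpow, ho.neg_one_zpow]
      rw [h1, zpow_neg, mul_assoc, ← div_eq_mul_inv, ← div_zpow, ← mul_zpow, neg_one_mul]
  · have hb0 : 0 ≤ (ord F b).toAdd := by
      rw [ord_nonneg_iff]
      have : (b : F) = 1 - a := by rw [← hab]; ring
      rw [this]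
      refine (Valuation.map_sub _ _ _).trans (max_le (Valuation.map_one _).le ?_)
      exact (ord_nonneg_iff a).1 h.ge
    rcases hb0.eq_or_lt with h0 | h0
    · refine key 1 0 (map_one _) (by simp) ?_
      simp [tameElt, h, ← h0]
    · refine key a (ord F b).toAdd h ?_ ?_
      · rw [ha, Valuation.map_neg]
        exact (ord_pos_iff b).1 h0
      · simp [tameElt, h]
  · have hva := (ord_pos_iff a).1 h
    have hvb : ord F b = 1 := by
      apply hone
      have : (b : F) = 1 - a := by rw [← hab]; ring
      rw [this, Valuation.map_sub_eq_of_lt_left _ (by rwa [Valuation.map_one]), map_one]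
    refine key b (-(ord F a).toAdd) hvb ?_ ?_
    · rwa [hb, Valuation.map_neg]
    · simp [tameElt, hvb]

lemma tameSymbol_mul_left (a a' b : Fˣ) :
    tameSymbol (a * a') b = tameSymbol a b * tameSymbol a' b := by
  rw [tameSymbol, tameSymbol, tameSymbol, ← map_mul]
  exact congrArg _ (Subtype.ext (tameElt_mul_left a a' b))

lemma tameSymbol_mul_right (a b b' : Fˣ) :
    tameSymbol a (b * b') = tameSymbol a b * tameSymbol a b' := by
  rw [tameSymbol, tameSymbol, tameSymbol, ← map_mul]
  exact congrArg _ (Subtype.ext (tameElt_mul_right a b b'))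

variable (F) in
/-- The tame symbol as a bilinear map. -/
def tameBilin : Additive Fˣ →ₗ[ℤ] Additive Fˣ →ₗ[ℤ] Additive 𝓀[F]ˣ :=
  (AddMonoidHom.mk' (fun a : Additive Fˣ =>
    (AddMonoidHom.mk' (fun b : Additive Fˣ => Additive.ofMul (tameSymbol a.toMul b.toMul))
      (fun b b' => congrArg Additive.ofMul
        (tameSymbol_mul_right a.toMul b.toMul b'.toMul))).toIntLinearMap)
    (fun a a' => LinearMap.ext fun b => congrArg Additive.ofMul
      (tameSymbol_mul_left a.toMul a'.toMul b.toMul))).toIntLinearMap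

variable (F) in
/-- The tame symbol `K₂(F) → 𝔣^×`. -/
def tame : MilnorK2 F →ₗ[ℤ] Additive 𝓀[F]ˣ :=
  (steinberg F).liftQ (TensorProduct.lift (tameBilin F)) (by
    rw [steinberg, Submodule.span_le]
    rintro _ ⟨a, b, h, rfl⟩
    exact congrArg Additive.ofMul (tameSymbol_steinberg h))

variable (F) in
/-- The map `𝔣^× → μ_n(F)`: the Teichmüller lifting followed by the power `(q - 1) / n`. -/
def psi (n : ℕ) (hn : n ∣ Nat.card 𝓀[F] - 1) : 𝓀[F]ˣ →* rootsOfUnity n F :=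
  (((inclUnit F).comp (teichmuller F)).comp
    (powMonoidHom ((Nat.card 𝓀[F] - 1) / n))).codRestrict _ (fun x => by
      rw [mem_rootsOfUnity, ← map_pow]
      change inclUnit F (teichmuller F ((x ^ n) ^ ((Nat.card 𝓀[F] - 1) / n))) = 1
      rw [← pow_mul, Nat.mul_div_cancel' hn, pow_card_sub_one, map_one, map_one])

variable (F) in
/-- The tame Hilbert symbol `K₂(F) → 𝔣^× → μ_n(F)`. -/
def hilbert (n : ℕ) (hn : n ∣ Nat.card 𝓀[F] - 1) : MilnorK2 F →+ Additive (rootsOfUnity n F) :=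
  (psi F n hn).toAdditive.comp (tame F).toAddMonoidHom

end LocalField

/-! ### Tame metaplectic covers and their centers -/

section Cover

variable {Y F L : Type u} [AddCommGroup Y] [Field F] [Field L] [Algebra F L]
  [DistribMulAction (L ≃ₐ[F] L) Y]

/-- The map `K₂(F) → T'(F)`. -/
def CentralExtension.iF (T' : CentralExtension Y F L) (k : MilnorK2 F) :
    T'.E.obj.obj (op (pt F)) :=
  T'.i (pt F) (.ofAdd (toK2 (pt F) (MilnorK2.map (algebraMap F (Fun (pt F))) k)))

lemma CentralExtension.π_iF (T' : CentralExtension Y F L) (k : MilnorK2 F) :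
    T'.π (pt F) (T'.iF k) = 1 := by
  have h : T'.iF k ∈ (T'.i (pt F)).range := ⟨_, rfl⟩
  rwa [T'.range_i] at h

variable [ValuativeRel F] [TopologicalSpace F] [IsNonarchimedeanLocalField F]
  (T' : CentralExtension Y F L) (n : ℕ) (hn : n ∣ Nat.card 𝓀[F] - 1)

/-- The elements `((k)_n⁻¹, k)` of `μ_n × T'(F)`, for `k` in `K₂(F)`. -/
def coverRelations : Set (rootsOfUnity n F × T'.E.obj.obj (op (pt F))) :=
  Set.range fun k : MilnorK2 F => ((hilbert F n hn k).toMul⁻¹, T'.iF k)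

/-- The tame metaplectic cover of `T(F)`: the push-forward of
`1 → K₂(F) → T'(F) → T(F) → 1` along the tame Hilbert symbol `K₂(F) → μ_n(F)`. -/
abbrev TameCover : Type (u + 1) :=
  (rootsOfUnity n F × T'.E.obj.obj (op (pt F))) ⧸
    Subgroup.normalClosure (coverRelations T' n hn)

/-- The projection of the cover to `T(F)` (as the group of `Spec F`-points of the torus). -/
def TameCover.proj : TameCover T' n hn →* Multiplicative (torus Y F L (Fun (pt F))) :=
  QuotientGroup.lift _ ((T'.π (pt F)).comp (MonoidHom.snd _ _)) (by
    change Subgroup.normalClosure (coverRelations T' n hn) ≤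
      ((T'.π (pt F)).comp (MonoidHom.snd _ _)).ker
    refine Subgroup.normalClosure_le_normal ?_
    rintro _ ⟨k, rfl⟩
    exact T'.π_iF k)

/-- `Z^†(T_F)`: the subgroup of `T_F` whose preimage in the cover is the center, i.e. the image
of the center; it is viewed inside `T_L = Y ⊗ L^×`. -/
def ZDagger : Set (TL Y L) :=
  {t | ∃ ht : t ∈ TF Y F L, ∃ z ∈ Subgroup.center (TameCover T' n hn),
    TameCover.proj T' n hn z = .ofAdd (torusBase Y F L (Fun (pt F)) ⟨t, ht⟩)}

end Cover

/-! ### Lattices -/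

section Lattice

variable {Y : Type u} [AddCommGroup Y]

/-- `W^# = {y | B(y, w) ∈ nℤ for all w ∈ W}`, where `B` is the bilinear form of `Q`. -/
def sharp (Q : QuadraticForm ℤ Y) (n : ℕ) (W : AddSubgroup Y) : AddSubgroup Y where
  carrier := {y | ∀ w ∈ W, (n : ℤ) ∣ QuadraticMap.polar Q y w}
  zero_mem' w _ := by simp
  add_mem' ha hb w hw := by
    rw [QuadraticMap.polar_add_left]
    exact dvd_add (ha w hw) (hb w hw)
  neg_mem' ha w hw := by
    rw [QuadraticMap.polar_neg_left]
    exact (ha w hw).neg_right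

/-- The sublattice `Y^Γ` of invariants. -/
def invariants (Γ Y : Type u) [Group Γ] [AddCommGroup Y] [DistribMulAction Γ Y] :
    AddSubgroup Y where
  carrier := {y | ∀ σ : Γ, σ • y = y}
  zero_mem' _ := smul_zero _
  add_mem' ha hb σ := by rw [smul_add, ha σ, hb σ]
  neg_mem' ha σ := by rw [smul_neg, ha σ]

/-- `Ȳ = Y / N Y`. -/
abbrev Ybar (Y : Type u) [AddCommGroup Y] (N : ℕ) : Type u :=
  Y ⧸ (nsmulAddMonoidHom N : Y →+ Y).range

/-- The element `y(u) = y ⊗ u` of `T_L`. -/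
def cochar {L : Type u} [Field L] (u : Lˣ) : Y →+ TL Y L :=
  (LinearMap.flip (TensorProduct.mk ℤ Y (Additive Lˣ)) (.ofMul u)).toAddMonoidHom

/-- The element `ȳ(u)` of `T_L`, for `ȳ ∈ Y / N Y` and `u ^ N = 1`. -/
def cocharBar {L : Type u} [Field L] (u : Lˣ) (N : ℕ) (hu : u ^ N = 1) : Ybar Y N →+ TL Y L :=
  QuotientAddGroup.lift _ (cochar u) (by
    rintro _ ⟨y, rfl⟩
    change (N • y) ⊗ₜ[ℤ] Additive.ofMul u = 0
    rw [TensorProduct.smul_tmul, ← ofMul_pow, hu, ofMul_one, TensorProduct.tmul_zero])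

end Lattice

/-! ### Unramified extensions -/

section Unramified

variable (F L : Type u) [Field F] [ValuativeRel F] [TopologicalSpace F]
  [IsNonarchimedeanLocalField F] [Field L] [ValuativeRel L] [TopologicalSpace L]
  [IsNonarchimedeanLocalField L] [Algebra F L]

/-- `L / F` is an unramified extension of local fields: the normalized valuation of `L` extends
that of `F`, and the residue extension has degree `[L : F]`. -/
structure IsUnramified : Prop where
  ord_eq : ∀ x : Fˣ, ord L (Units.map (algebraMap F L : F →* L) x) = ord F x
  card_eq : Nat.card 𝓀[L] = Nat.card 𝓀[F] ^ Module.finrank F L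

variable {F L} in
/-- The Teichmüller lift, in `L^×`, of an element of `𝔩^×`. -/
def teich (θ : 𝓀[L]ˣ) : Lˣ := inclUnit L (teichmuller L θ)

variable {F L} in
lemma teich_pow (h : IsUnramified F L) (θ : 𝓀[L]ˣ) :
    teich θ ^ (Nat.card 𝓀[F] ^ Module.finrank F L - 1) = 1 := by
  rw [← h.card_eq, teich, ← map_pow, ← map_pow, pow_card_sub_one, map_one, map_one]

/-- `T_L^1`: the kernel of the reduction `Y ⊗ 𝒪_L^× → Y ⊗ 𝔩^×`, as a subgroup of `T_L`. -/
def TL1 (Y : Type u) [AddCommGroup Y] : AddSubgroup (TL Y L) :=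
  (LinearMap.ker (TensorProduct.map (LinearMap.id : Y →ₗ[ℤ] Y)
    (redUnit L).toAdditive.toIntLinearMap)).toAddSubgroup.map
      (TensorProduct.map (LinearMap.id : Y →ₗ[ℤ] Y)
        (inclUnit L).toAdditive.toIntLinearMap).toAddMonoidHom

/-- `T_F^1`: the kernel of the reduction `T_F^∘ → T̄_𝔣`, i.e. the invariants of `T_L^1`. -/
def TF1 (Y : Type u) [AddCommGroup Y] [DistribMulAction (L ≃ₐ[F] L) Y] : AddSubgroup (TL Y L) :=
  TL1 L Y ⊓ TF Y F L

end Unramified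

end

end MetaplecticTorus

open MetaplecticTorus

namespace MetaplecticTorus

/-! The center of a central extension is read off from its commutator pairing. A commutator of two
elements of `T'(F)` lies over `1`, so it comes from some `k` in `K₂(F)`, and the element is central
in the cover exactly when these `k` always have trivial Hilbert symbol. Over `L` the extension has a
section with explicit cocycle, and there the commutator is the difference of the two cocycle values.
Because `L/F` is unramified, the tame symbols of `F` and `L` agree under the injection of residue
fields, so triviality can be tested over `L`: with `m = (q - 1)/n`, `mem_ZDagger_iff` says that `t`
must lie in `T_F` and be killed by `m` times the pairing `y₁(a), y₂(b) ↦ B(y₁, y₂) (a, b)_tame`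
against all of `T_F`.

The pairing factors through the valuation in `Y` and the angular component in `Y ⊗ 𝔩^×`, both of
which vanish appropriately on `T_F^1`. On elements with data `(y₁, y₂ ⊗ θ)` and `(x, y' ⊗ θ)` it is
`(-1)^B(y₁, x) θ^(B(y₂, x) - B(y', y₁))`. Invariance under Frobenius means that `y₁` and `x` are
`Γ`-invariant and that `δ_q y₂ = N w`, `δ_q y' = N w'` with `N = q^d - 1`. For invariant `x`,
pairing `δ_q y = N w` with `x` gives `(q - 1) B(y, x) = N B(w, x)`; hence `N ∣ m B(y, x)` iff `n ∣
B(w, x)` (`sub_one_mul_polar`, `dvd_mul_iff_dvd`).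

So orthogonality to the Teichmüller points of `T_F` says `n ∣ B(y₁, w')`. Every `w'` in `Y` occurs,
since `∑ (qγ)^i w'` solves `δ_q y' = N w'`; thus `y₁ ∈ Y^#`. Orthogonality to the points `x(ϖ)` then
says `w ∈ Y^{Γ#}`. The remaining condition `y₂ ∈ Y^#` is a consequence: `y₂ = ∑ (qγ)^i w`, and
modulo `n`, where `q ≡ 1`, its pairing with `z` is that of `w` with the trace of `z`
(`twistedNorm_mem_sharp`). -/

/-! ### One-point schemes in the big Zariski site -/

/-- A covering sieve of a one-point scheme is the maximal sieve. -/
lemma eq_top_of_mem_zariski {F : Type u} [Field F] {X : FTSch F} [Nonempty X.left]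
    [Subsingleton X.left] {S : Sieve X} (hS : S ∈ zariski F X) : S = ⊤ := by
  obtain ⟨x⟩ := (inferInstance : Nonempty X.left)
  obtain ⟨U, j, hj, hjo, u, hu⟩ := hS x
  have hs : Surjective j.left := ⟨fun y => ⟨u, Subsingleton.elim _ _⟩⟩
  -- A surjective open immersion is an isomorphism, so the sieve contains a split epimorphism, hence
  -- the identity.
  have hi : IsIso j.left := (isIso_iff_isOpenImmersion_and_surjective _).2 ⟨hjo, hs⟩
  let r : X ⟶ U := MorphismProperty.Over.homMk (inv j.left) (by
    rw [← MorphismProperty.Over.w j, IsIso.inv_hom_id_assoc]) trivial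
  have hr : r ≫ j = 𝟙 X := by
    apply MorphismProperty.Over.Hom.ext
    exact IsIso.inv_hom_id j.left
  rw [← Sieve.id_mem_iff_eq_top, ← hr]
  exact S.downward_closed hj r

/-- Over a one-point scheme, sections of the sheaf `K₂` are given by symbols. -/
lemma toK2_bijective {F : Type u} [Field F] (X : FTSch F) [Nonempty X.left]
    [Subsingleton X.left] : Function.Bijective (toK2 X) := by
  -- The unit of sheafification is locally injective and locally surjective; since the only covering
  -- sieve is the maximal one, "locally" means on `X` itself.
  refine Function.Bijective.comp (g := ((toSheafify (zariski F) (milnorPresheaf F)).app (op X)).hom)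
    ⟨fun a b hab => ?_, fun a => ?_⟩ (AddEquiv.ulift.symm).bijective
  · have h := Presheaf.equalizerSieve_mem (zariski F) (toSheafify (zariski F) (milnorPresheaf F))
      a b hab
    exact (Presheaf.equalizerSieve_eq_top_iff a b).1 (eq_top_of_mem_zariski (X := X) h)
  · have h := Presheaf.imageSieve_mem (zariski F) (toSheafify (zariski F) (milnorPresheaf F))
      (U := op X) a
    have h1 := (Sieve.id_mem_iff_eq_top).2 (eq_top_of_mem_zariski (X := X) h)
    obtain ⟨t, ht⟩ := h1
    exact ⟨t, ht.trans (by
      rw [op_id, CategoryTheory.Functor.map_id]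
      rfl)⟩

lemma toK2_natural {F : Type u} [Field F] {X X' : FTSch F} (f : X' ⟶ X) (k : MilnorK2 (Fun X)) :
    (K2 F).obj.map f.op (toK2 X k) =
      toK2 X' (MilnorK2.map (Fun.pullback f).toRingHom k) :=
  (NatTrans.naturality_apply (toSheafify (zariski F) (milnorPresheaf F)) f.op
    (AddEquiv.ulift.symm k)).symm

instance (F : Type u) [Field F] : Nonempty (pt F).left :=
  inferInstanceAs (Nonempty (Spec (CommRingCat.of F)))

instance (F : Type u) [Field F] : Subsingleton (pt F).left :=
  inferInstanceAs (Subsingleton (PrimeSpectrum F))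

lemma algebraMap_pt_bijective (F : Type u) [Field F] :
    Function.Bijective (algebraMap F (Fun (pt F))) :=
  ConcreteCategory.bijective_of_isIso (Scheme.ΓSpecIso (CommRingCat.of F)).inv

section SpecL

variable (F L : Type u) [Field F] [Field L] [Algebra F L] [FiniteDimensional F L]

/-- The spectrum of a finite extension of `F`, as a scheme of finite type over `F`. -/
noncomputable def ptExt : FTSch F :=
  MorphismProperty.Over.mk ⊤ (Spec.map (CommRingCat.ofHom (algebraMap F L)))
    ⟨(HasRingHomProperty.Spec_iff (P := @LocallyOfFiniteType)).2
      (RingHom.finiteType_algebraMap.2 inferInstance), inferInstance⟩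

instance : Nonempty (ptExt F L).left :=
  inferInstanceAs (Nonempty (Spec (CommRingCat.of L)))

instance : Subsingleton (ptExt F L).left :=
  inferInstanceAs (Subsingleton (PrimeSpectrum L))

/-- The structural morphism `Spec L → Spec F`. -/
noncomputable def ptExtHom : ptExt F L ⟶ pt F :=
  MorphismProperty.Over.homMk (Spec.map (CommRingCat.ofHom (algebraMap F L)))
    (Category.comp_id _) trivial

/-- The identification of `L` with the functions on `Spec L`. -/
noncomputable def ptExtFun : L →ₐ[F] Fun (ptExt F L) where
  toRingHom := (Scheme.ΓSpecIso (CommRingCat.of L)).inv.hom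
  commutes' a := DFunLike.congr_fun (congrArg CommRingCat.Hom.hom
    (Scheme.ΓSpecIso_inv_naturality (CommRingCat.ofHom (algebraMap F L)))) a

lemma ptExtFun_bijective : Function.Bijective (ptExtFun F L) :=
  ConcreteCategory.bijective_of_isIso (Scheme.ΓSpecIso (CommRingCat.of L)).inv

end SpecL

/-! ### The tame symbol in an unramified extension -/

section Unramified

variable {F L : Type u} [Field F] [ValuativeRel F] [TopologicalSpace F]
  [IsNonarchimedeanLocalField F] [Field L] [ValuativeRel L] [TopologicalSpace L]
  [IsNonarchimedeanLocalField L] [Algebra F L]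

lemma IsUnramified.valuation_le_one (h : IsUnramified F L) {x : F} (hx : valuation F x ≤ 1) :
    valuation L (algebraMap F L x) ≤ 1 := by
  rcases eq_or_ne x 0 with rfl | h0
  · simp
  · have h1 := (ord_nonneg_iff (Units.mk0 x h0)).2 hx
    rw [← h.ord_eq] at h1
    exact (ord_nonneg_iff _).1 h1

lemma IsUnramified.valuation_lt_one (h : IsUnramified F L) {x : F} (hx : valuation F x < 1) :
    valuation L (algebraMap F L x) < 1 := by
  rcases eq_or_ne x 0 with rfl | h0
  · simp
  · have h1 := (ord_pos_iff (Units.mk0 x h0)).2 hx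
    rw [← h.ord_eq] at h1
    exact (ord_pos_iff _).1 h1

/-- The inclusion of the rings of integers. -/
noncomputable def IsUnramified.intMap (h : IsUnramified F L) : 𝒪[F] →+* 𝒪[L] :=
  (algebraMap F L).restrict 𝒪[F] 𝒪[L] fun _ hx => h.valuation_le_one hx

/-- The inclusion of the residue fields. -/
noncomputable def IsUnramified.resMap (h : IsUnramified F L) : 𝓀[F] →+* 𝓀[L] :=
  Ideal.quotientMap 𝓂[L] h.intMap fun x hx => by
    change h.intMap x ∈ 𝓂[L]
    rw [IsLocalRing.mem_maximalIdeal, mem_nonunits_iff,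
      Valuation.Integer.not_isUnit_iff_valuation_lt_one] at hx ⊢
    exact h.valuation_lt_one hx

lemma IsUnramified.map_mem_ker (h : IsUnramified F L) {x : Fˣ} (hx : x ∈ (ord F).ker) :
    Units.map (algebraMap F L : F →* L) x ∈ (ord L).ker := by
  rwa [MonoidHom.mem_ker, h.ord_eq]

lemma IsUnramified.resMap_resUnit (h : IsUnramified F L) (x : (ord F).ker) :
    Units.map (h.resMap : 𝓀[F] →* 𝓀[L]) (resUnit F x) =
      resUnit L ⟨Units.map (algebraMap F L : F →* L) x, h.map_mem_ker x.2⟩ :=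
  Units.ext rfl

/-- Ramification index one enters here: the exponents are valuations, and they do not change from
`F` to `L`. -/
lemma IsUnramified.tameElt_map (h : IsUnramified F L) (a b : Fˣ) :
    tameElt (Units.map (algebraMap F L : F →* L) a) (Units.map (algebraMap F L : F →* L) b) =
      Units.map (algebraMap F L : F →* L) (tameElt a b) := by
  have h1 : Units.map (algebraMap F L : F →* L) (-1) = -1 := Units.ext (by simp)
  rw [tameElt, tameElt, h.ord_eq, h.ord_eq, map_mul, map_mul, map_zpow, map_zpow, map_zpow, h1]

lemma IsUnramified.tameSymbol_map (h : IsUnramified F L) (a b : Fˣ) :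
    tameSymbol (Units.map (algebraMap F L : F →* L) a) (Units.map (algebraMap F L : F →* L) b) =
      Units.map (h.resMap : 𝓀[F] →* 𝓀[L]) (tameSymbol a b) := by
  rw [tameSymbol, tameSymbol, h.resMap_resUnit]
  exact congrArg _ (Subtype.ext (h.tameElt_map a b))

lemma IsUnramified.tame_map (h : IsUnramified F L) (k : MilnorK2 F) :
    tame L (MilnorK2.map (algebraMap F L) k) = unitsMap h.resMap (tame F k) := by
  have : (tame L).comp (MilnorK2.map (algebraMap F L)) = (unitsMap h.resMap).comp (tame F) :=
    MilnorK2.hom_ext fun a b => congrArg Additive.ofMul (h.tameSymbol_map a.toMul b.toMul)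
  exact DFunLike.congr_fun this k

/-- The Teichmüller lift is injective, with reduction as left inverse, so only the power `(q - 1) /
n` contributes to the kernel. -/
lemma hilbert_eq_zero_iff (n : ℕ) (hn : n ∣ Nat.card 𝓀[F] - 1) (k : MilnorK2 F) :
    hilbert F n hn k = 0 ↔ ((Nat.card 𝓀[F] - 1) / n) • tame F k = 0 := by
  set x : 𝓀[F]ˣ := (tame F k).toMul with hx
  have h1 : hilbert F n hn k = 0 ↔
      inclUnit F (teichmuller F (x ^ ((Nat.card 𝓀[F] - 1) / n))) = 1 :=
    Subtype.ext_iff (a1 := psi F n hn x) (a2 := 1)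
  have h2 : ((Nat.card 𝓀[F] - 1) / n) • tame F k = 0 ↔
      x ^ ((Nat.card 𝓀[F] - 1) / n) = 1 := Iff.rfl
  rw [h1, h2]
  refine ⟨fun h => ?_, fun h => by rw [h, map_one, map_one]⟩
  have h3 : teichmuller F (x ^ ((Nat.card 𝓀[F] - 1) / n)) = 1 :=
    Units.ext (Subtype.ext (congrArg Units.val h))
  rw [← redUnit_teichmuller (x ^ ((Nat.card 𝓀[F] - 1) / n)), h3, map_one]

/-- Injectivity of the residue field map allows the test to be made over `L`, where the torus
splits; no injectivity of `K₂(F) → K₂(L)` is needed. -/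
lemma IsUnramified.hilbert_eq_zero_iff (h : IsUnramified F L) (n : ℕ)
    (hn : n ∣ Nat.card 𝓀[F] - 1) (k : MilnorK2 F) :
    hilbert F n hn k = 0 ↔
      ((Nat.card 𝓀[F] - 1) / n) • tame L (MilnorK2.map (algebraMap F L) k) = 0 := by
  have hi : Function.Injective (unitsMap h.resMap) := Units.map_injective h.resMap.injective
  rw [MetaplecticTorus.hilbert_eq_zero_iff, h.tame_map,
    ← map_nsmul (unitsMap h.resMap), map_eq_zero_iff _ hi]

end Unramified

/-! ### The tame symbol in terms of a uniformizer -/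

section Uniformizer

variable {L : Type u} [Field L] [ValuativeRel L] [TopologicalSpace L]
  [IsNonarchimedeanLocalField L]

lemma tameSymbol_swap (a b : Lˣ) : tameSymbol b a = (tameSymbol a b)⁻¹ := by
  rw [tameSymbol, tameSymbol, ← map_inv]
  refine congrArg _ (Subtype.ext ?_)
  change tameElt b a = (tameElt a b)⁻¹
  have h (k : ℤ) : ((-1 : Lˣ) ^ k)⁻¹ = (-1) ^ k := by rw [← inv_zpow, inv_neg, inv_one]
  rw [tameElt, tameElt, mul_inv, mul_inv, h, ← zpow_neg, ← zpow_neg, neg_neg,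
    mul_comm (ord L b).toAdd, mul_right_comm]

/-- The angular component `a ↦ a ϖ^{-v(a)} mod 𝔪` of a uniformizer `ϖ`. -/
noncomputable def angular (ϖ : Lˣ) (hϖ : ord L ϖ = .ofAdd 1) : Lˣ →* 𝓀[L]ˣ where
  toFun a := resUnit L ⟨a * ϖ ^ (-(ord L a).toAdd), by
    rw [MonoidHom.mem_ker, map_mul, map_zpow, hϖ, ← ofAdd_zsmul, smul_eq_mul, mul_one, ofAdd_neg,
      ofAdd_toAdd, mul_inv_cancel]⟩
  map_one' := (congrArg _ (Subtype.ext (by simp))).trans (map_one (resUnit L))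
  map_mul' a b := by
    refine (congrArg _ (Subtype.ext ?_)).trans (map_mul (resUnit L) _ _)
    simp only [Subgroup.coe_mul, map_mul, toAdd_mul, neg_add, zpow_add]
    exact mul_mul_mul_comm _ _ _ _

variable {ϖ : Lˣ} (hϖ : ord L ϖ = .ofAdd 1)

lemma angular_of_mem_ker {a : Lˣ} (ha : a ∈ (ord L).ker) : angular ϖ hϖ a = resUnit L ⟨a, ha⟩ :=
  congrArg (resUnit L) (Subtype.ext (by simp [MonoidHom.mem_ker.1 ha]))

lemma angular_self : angular ϖ hϖ ϖ = 1 :=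
  (congrArg _ (Subtype.ext (by simp [hϖ]))).trans (map_one (resUnit L))

lemma inclUnit_mem_ker (u : 𝒪[L]ˣ) : inclUnit L u ∈ (ord L).ker := by
  have h (u : 𝒪[L]ˣ) : 0 ≤ (ord L (inclUnit L u)).toAdd :=
    (ord_nonneg_iff _).2 (u : 𝒪[L]).2
  have h1 := h u
  have h2 := h u⁻¹
  rw [map_inv, map_inv, toAdd_inv] at h2
  exact Multiplicative.toAdd.injective (le_antisymm (by simpa using h2) h1)

lemma angular_inclUnit (u : 𝒪[L]ˣ) : angular ϖ hϖ (inclUnit L u) = redUnit L u := by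
  rw [angular_of_mem_ker hϖ (inclUnit_mem_ker u)]
  exact congrArg (redUnit L) (Units.ext (Subtype.ext rfl))

lemma angular_teich (θ : 𝓀[L]ˣ) : angular ϖ hϖ (teich θ) = θ := by
  rw [teich, angular_inclUnit, redUnit_teichmuller]

/-- The powers of `ϖ` contributed by `a ^ v(b)` and `b ^ (-v(a))` cancel. -/
lemma tameSymbol_eq_angular (a b : Lˣ) :
    tameSymbol a b = (-1) ^ ((ord L a).toAdd * (ord L b).toAdd) *
      angular ϖ hϖ a ^ (ord L b).toAdd * angular ϖ hϖ b ^ (-(ord L a).toAdd) := by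
  have hneg : (-1 : Lˣ) ∈ (ord L).ker := ord_neg_one
  have h1 : resUnit L ⟨-1, hneg⟩ = -1 := Units.ext (by
    change IsLocalRing.residue 𝒪[L] (intUnit L ⟨-1, hneg⟩ : 𝒪[L]) = -1
    rw [← map_one (IsLocalRing.residue 𝒪[L]), ← map_neg]
    exact congrArg _ (Subtype.ext (by simp [intUnit])))
  rw [← h1, tameSymbol]
  simp only [angular, MonoidHom.coe_mk, OneHom.coe_mk, ← map_zpow, ← map_mul]
  refine congrArg _ (Subtype.ext ?_)
  simp only [tameElt, Subgroup.coe_mul, SubgroupClass.coe_zpow, mul_zpow, ← zpow_mul]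
  have h2 : -(ord L b).toAdd * -(ord L a).toAdd = -(-(ord L a).toAdd * (ord L b).toAdd) := by ring
  rw [h2, zpow_neg ϖ (-(ord L a).toAdd * _)]
  generalize ϖ ^ (-(ord L a).toAdd * (ord L b).toAdd) = x
  rw [mul_assoc, mul_assoc, mul_assoc]
  congr 2
  rw [mul_comm (b ^ _), mul_inv_cancel_left]

end Uniformizer

/-! ### Commutators in groups -/

/-- Central factors do not affect a commutator, so `a`, `b` may be replaced by `s`, `t`. In the
application `s`, `t`, `u` are values of a section at `t₁`, `t₂`, `t₁ + t₂`, and `c`, `d` are the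
cocycle values in the two orders. -/
lemma commutator_eq_of_central {G : Type*} [Group G] {a b s t c d : G}
    (ha : a * s⁻¹ ∈ Subgroup.center G) (hb : b * t⁻¹ ∈ Subgroup.center G)
    (hc : c ∈ Subgroup.center G) (hd : d ∈ Subgroup.center G) {u : G} (hst : s * t = u * c)
    (hts : t * s = u * d) : a * b * (b * a)⁻¹ = c * d⁻¹ := by
  obtain ⟨x, hx, rfl⟩ : ∃ x ∈ Subgroup.center G, a = x * s := ⟨_, ha, by group⟩
  obtain ⟨y, hy, rfl⟩ : ∃ y ∈ Subgroup.center G, b = y * t := ⟨_, hb, by group⟩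
  rw [Subgroup.mem_center_iff] at hx hy
  have h1 : x * s * (y * t) = x * y * (u * c) := by
    rw [← hst, mul_assoc, mul_assoc, ← mul_assoc s, hy s]; group
  have h2 : y * t * (x * s) = x * y * (u * d) := by
    rw [← hts, mul_assoc, ← mul_assoc t, hx t, ← hx y]; group
  have hcd := Subgroup.mem_center_iff.1 (mul_mem hc (inv_mem hd))
  have h3 : x * y * (u * c) * (x * y * (u * d))⁻¹ =
      (x * y) * (u * (c * d⁻¹) * u⁻¹) * (x * y)⁻¹ := by group
  rw [h1, h2, h3, hcd u, mul_inv_cancel_right, hcd (x * y), mul_inv_cancel_right]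

lemma map_mul_mul_inv {G H : Type*} [Group G] [Group H] (f : G →* H) (a b : G) :
    f (a * b * (b * a)⁻¹) = f a * f b * (f b * f a)⁻¹ := by
  rw [map_mul, map_inv, map_mul, map_mul]

lemma mul_inv_mem_of_map_eq {G H : Type*} [Group G] [Group H] (f : G →* H) {K : Subgroup G}
    (hK : K = f.ker) {a b : G} (h : f a = f b) : a * b⁻¹ ∈ K := by
  rw [hK, MonoidHom.mem_ker, map_mul, map_inv, h, mul_inv_cancel]

lemma map_commutator_eq_one {G A : Type*} [Group G] [CommGroup A] (f : G →* A) (a b : G) :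
    f (a * b * (b * a)⁻¹) = 1 := by
  rw [map_mul, map_inv, map_mul, map_mul, mul_comm (f a), mul_inv_cancel]

/-- The commutator of elements with prescribed images in a central extension, in terms of a
section with a cocycle `c`. -/
lemma commutator_eq_of_cocycle {G : Type*} [Group G] {K K' T : Type*} [AddCommGroup K]
    [AddCommGroup K'] [AddCommGroup T] (i : Multiplicative K →* G)
    (hi : Function.Injective i) (hc : i.range ≤ Subgroup.center G) (j : K' →+ K)
    (hj : Function.Injective j) (s : T → G) (c : T → T → K')
    (hmul : ∀ t₁ t₂, s t₁ * s t₂ = s (t₁ + t₂) * i (.ofAdd (j (c t₁ t₂))))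
    {a b : G} {t₁ t₂ : T} (ha : a * (s t₁)⁻¹ ∈ i.range) (hb : b * (s t₂)⁻¹ ∈ i.range) {k : K'}
    (hk : a * b * (b * a)⁻¹ = i (.ofAdd (j k))) : k = c t₁ t₂ - c t₂ t₁ := by
  have h := commutator_eq_of_central (hc ha) (hc hb) (hc ⟨_, rfl⟩) (hc ⟨_, rfl⟩) (hmul t₁ t₂)
    ((hmul t₂ t₁).trans (by rw [add_comm]))
  rw [hk, ← map_inv, ← map_mul] at h
  apply hj
  rw [map_sub, sub_eq_add_neg]
  exact congrArg Multiplicative.toAdd (hi h)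

/-! ### Functoriality of `Y ⊗ A^×` and of the symbol pairing -/

section Torus

variable {Y : Type u} [AddCommGroup Y]

lemma symbolPairing_map (D : LinearMap.BilinForm ℤ Y) {A B : Type u} [CommRing A] [CommRing B]
    (f : A →+* B) (s t : Y ⊗[ℤ] Additive Aˣ) :
    MilnorK2.map f (symbolPairing D A s t) =
      symbolPairing D B (cocharMap (AddMonoidHom.id Y) f s) (cocharMap (AddMonoidHom.id Y) f t) := by
  have : (symbolPairing D A).compr₂ (MilnorK2.map f) =
      (symbolPairing D B).compl₁₂ (cocharMap (AddMonoidHom.id Y) f)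
        (cocharMap (AddMonoidHom.id Y) f) := by
    refine TensorProduct.ext' fun y₁ a => TensorProduct.ext' fun y₂ b => ?_
    exact map_zsmul (MilnorK2.map f) (D y₁ y₂) (symb A a b)
  exact DFunLike.congr_fun (DFunLike.congr_fun this s) t

lemma cocharMap_cocharMap {A B C : Type u} [CommRing A] [CommRing B] [CommRing C]
    (f : A →+* B) (g : B →+* C) (t : Y ⊗[ℤ] Additive Aˣ) :
    cocharMap (AddMonoidHom.id Y) g (cocharMap (AddMonoidHom.id Y) f t) =
      cocharMap (AddMonoidHom.id Y) (g.comp f) t := by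
  have : (cocharMap (AddMonoidHom.id Y) g).comp (cocharMap (AddMonoidHom.id Y) f) =
      cocharMap (AddMonoidHom.id Y) (g.comp f) := TensorProduct.ext' fun y a => rfl
  exact DFunLike.congr_fun this t

lemma cocharMap_id {A : Type u} [CommRing A] (t : Y ⊗[ℤ] Additive Aˣ) :
    cocharMap (AddMonoidHom.id Y) (RingHom.id A) t = t := by
  have : cocharMap (AddMonoidHom.id Y) (RingHom.id A) = LinearMap.id :=
    TensorProduct.ext' fun y a => rfl
  exact DFunLike.congr_fun this t

lemma cocharMap_bijective {A B : Type u} [CommRing A] [CommRing B] (f : A →+* B)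
    (hf : Function.Bijective f) :
    Function.Bijective (cocharMap (Y := Y) (AddMonoidHom.id Y) f) := by
  let e := RingEquiv.ofBijective f hf
  refine Function.bijective_iff_has_inverse.2
    ⟨cocharMap (AddMonoidHom.id Y) (e.symm : B →+* A), fun t => ?_, fun t => ?_⟩
  · rw [cocharMap_cocharMap]
    convert cocharMap_id t
    ext a
    exact e.symm_apply_apply a
  · rw [cocharMap_cocharMap]
    convert cocharMap_id t
    ext a
    exact e.apply_symm_apply a

lemma MilnorK2.map_map {A B C : Type u} [CommRing A] [CommRing B] [CommRing C]
    (f : A →+* B) (g : B →+* C) (k : MilnorK2 A) :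
    MilnorK2.map g (MilnorK2.map f k) = MilnorK2.map (g.comp f) k := by
  have : (MilnorK2.map g).comp (MilnorK2.map f) = MilnorK2.map (g.comp f) :=
    MilnorK2.hom_ext fun a b => rfl
  exact DFunLike.congr_fun this k

lemma MilnorK2.map_id_apply {A : Type u} [CommRing A] (k : MilnorK2 A) :
    MilnorK2.map (RingHom.id A) k = k := by
  have : MilnorK2.map (RingHom.id A) = LinearMap.id := MilnorK2.hom_ext fun a b => rfl
  exact DFunLike.congr_fun this k

lemma MilnorK2.map_bijective {A B : Type u} [CommRing A] [CommRing B] (f : A →+* B)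
    (hf : Function.Bijective f) : Function.Bijective (MilnorK2.map f) := by
  let e := RingEquiv.ofBijective f hf
  refine Function.bijective_iff_has_inverse.2
    ⟨MilnorK2.map (e.symm : B →+* A), fun t => ?_, fun t => ?_⟩
  · rw [MilnorK2.map_map]
    convert MilnorK2.map_id_apply t
    ext a
    exact e.symm_apply_apply a
  · rw [MilnorK2.map_map]
    convert MilnorK2.map_id_apply t
    ext a
    exact e.apply_symm_apply a

variable {F : Type u} [Field F] {L : Type u} [Field L] [Algebra F L]
  [DistribMulAction (L ≃ₐ[F] L) Y]

/-- Functions on `pt F` are only isomorphic to `F`; this identifies the `Spec F`-points of the torus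
with `TF`. -/
lemma torusBase_bijective (R : Type u) [CommRing R] [Algebra F R]
    (hR : Function.Bijective (algebraMap F R)) : Function.Bijective (torusBase Y F L R) := by
  have hi : Function.Bijective
      (Algebra.TensorProduct.includeRight : L →ₐ[F] R ⊗[F] L).toRingHom := by
    let e : F ≃ₐ[F] R := AlgEquiv.ofBijective (Algebra.ofId F R) hR
    let e' : L ≃ₐ[F] R ⊗[F] L := (Algebra.TensorProduct.lid F L).symm.trans
      (Algebra.TensorProduct.congr e AlgEquiv.refl)
    have h : ∀ x, e' x = (Algebra.TensorProduct.includeRight : L →ₐ[F] R ⊗[F] L) x := by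
      intro x
      simp [e']
    have h2 : ⇑(Algebra.TensorProduct.includeRight : L →ₐ[F] R ⊗[F] L).toRingHom = ⇑e' :=
      funext fun x => (h x).symm
    rw [h2]
    exact e'.bijective
  have hb := cocharMap_bijective (Y := Y) _ hi
  refine ⟨fun s t h => Subtype.ext (hb.1 (congrArg Subtype.val h)), fun t => ?_⟩
  obtain ⟨s, hs⟩ := hb.2 t.1
  refine ⟨⟨s, fun σ => hb.1 ?_⟩, Subtype.ext hs⟩
  rw [hs, ← t.2 σ, ← hs]
  refine (cocharMap_comm _ _ _ _ _ ?_ s).symm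
  intro x
  simp

/-- The composite `L → R ⊗ L → S ⊗ L → S` is `φ`. -/
lemma torusSplit_torusPull_torusBase {R S : Type u} [CommRing R] [Algebra F R] [CommRing S]
    [Algebra F S] (f : R →ₐ[F] S) (φ : L →ₐ[F] S) (t : TF Y F L) :
    torusSplit Y φ (torusPull Y L f (torusBase Y F L R t)) =
      cocharMap (AddMonoidHom.id Y) φ.toRingHom t := by
  change cocharMap _ _ (cocharMap _ _ (cocharMap _ _ (t : TL Y L))) = _
  rw [cocharMap_cocharMap, cocharMap_cocharMap]
  congr 2
  refine RingHom.ext fun x => ?_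
  simp

lemma symbolPairing_torusSplit {R S : Type u} [CommRing R] [Algebra F R] [CommRing S]
    [Algebra F S] (D : LinearMap.BilinForm ℤ Y) (f : R →ₐ[F] S) (φ : L →ₐ[F] S)
    (t₁ t₂ : TF Y F L) :
    symbolPairing D S (torusSplit Y φ (torusPull Y L f (torusBase Y F L R t₁)))
      (torusSplit Y φ (torusPull Y L f (torusBase Y F L R t₂))) =
      MilnorK2.map φ.toRingHom (symbolPairing D L t₁ t₂) := by
  rw [torusSplit_torusPull_torusBase, torusSplit_torusPull_torusBase, symbolPairing_map]

lemma torusPull_of_eq_id {R : Type u} [CommRing R] [Algebra F R] (f : R →ₐ[F] R)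
    (hf : ∀ x, f x = x) (t : torus Y F L R) : torusPull Y L f t = t := by
  obtain rfl : f = AlgHom.id F R := AlgHom.ext hf
  refine Subtype.ext ?_
  change cocharMap _ (Algebra.TensorProduct.map (AlgHom.id F R) (AlgHom.id F L)).toRingHom
    (t : Y ⊗[ℤ] Additive (R ⊗[F] L)ˣ) = t
  rw [Algebra.TensorProduct.map_id]
  exact cocharMap_id _

end Torus

section Commutator

variable {Y : Type u} [AddCommGroup Y] {F : Type u} [Field F] {L : Type u} [Field L] [Algebra F L]
  [DistribMulAction (L ≃ₐ[F] L) Y]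

/-! ### Commutators in a central extension -/

variable (T' : CentralExtension Y F L)

/-- Local surjectivity is surjectivity here, since a covering sieve of a one-point scheme contains
the identity. -/
lemma CentralExtension.π_surjective (X : FTSch F) [Nonempty X.left] [Subsingleton X.left] :
    Function.Surjective (T'.π X) := fun t =>
  Exists.elim (T'.locally_surjective X t.toAdd) fun _ hS =>
    Exists.imp (fun _ he => he.trans (congrArg Multiplicative.ofAdd
      (torusPull_of_eq_id _ (fun _ => rfl) _)))
      (hS.2 X (𝟙 X) (Sieve.id_mem_iff_eq_top.2 (eq_top_of_mem_zariski hS.1)))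

/-- The map `K₂(F) → T'(F)`, as a homomorphism. -/
noncomputable def CentralExtension.iFHom : Multiplicative (MilnorK2 F) →* T'.E.obj.obj (op (pt F)) :=
  (T'.i (pt F)).comp (((toK2 (pt F)).comp
    (MilnorK2.map (algebraMap F (Fun (pt F)))).toAddMonoidHom).toMultiplicative)

lemma CentralExtension.iF_injective : Function.Injective T'.iF := fun _ _ h =>
  (MilnorK2.map_bijective _ (algebraMap_pt_bijective F)).1
    ((toK2_bijective (pt F)).1 (T'.i_injective _ h))

lemma CentralExtension.exists_iF_eq {e : T'.E.obj.obj (op (pt F))} (he : T'.π (pt F) e = 1) :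
    ∃ k, T'.iF k = e := by
  obtain ⟨k, hk⟩ : e ∈ (T'.i (pt F)).range := by rwa [T'.range_i]
  obtain ⟨k', hk'⟩ := (toK2_bijective (pt F)).2 k.toAdd
  obtain ⟨k'', hk''⟩ := (MilnorK2.map_bijective _ (algebraMap_pt_bijective F)).2 k'
  refine ⟨k'', ?_⟩
  rw [CentralExtension.iF, hk'', hk', ofAdd_toAdd, hk]

lemma CentralExtension.map_mul_inv_mem_range {X P : FTSch F} (f : X ⟶ P)
    (s : torus Y F L (Fun X) → T'.E.obj.obj (op X)) (hs : ∀ t, T'.π X (s t) = .ofAdd t)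
    (e : T'.E.obj.obj (op P)) (t : torus Y F L (Fun P)) (h : T'.π P e = .ofAdd t) :
    T'.E.obj.map f.op e * (s (torusPull Y L (Fun.pullback f) t))⁻¹ ∈ (T'.i X).range :=
  mul_inv_mem_of_map_eq _ (T'.range_i X) ((T'.π_natural f e).trans
    ((congrArg (fun t => Multiplicative.ofAdd (torusPull Y L (Fun.pullback f) t.toAdd)) h).trans
      (hs _).symm))

lemma CentralExtension.map_commutator {X P : FTSch F} (f : X ⟶ P)
    (e₁ e₂ : T'.E.obj.obj (op P)) (k : MilnorK2 (Fun P))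
    (hk : e₁ * e₂ * (e₂ * e₁)⁻¹ = T'.i P (.ofAdd (toK2 P k))) :
    T'.E.obj.map f.op e₁ * T'.E.obj.map f.op e₂ *
        (T'.E.obj.map f.op e₂ * T'.E.obj.map f.op e₁)⁻¹ =
      T'.i X (.ofAdd (toK2 X (MilnorK2.map (Fun.pullback f).toRingHom k))) :=
  (map_mul_mul_inv (T'.E.obj.map f.op).hom e₁ e₂).symm.trans
    ((congrArg (T'.E.obj.map f.op) hk).trans ((T'.i_natural f _).trans
      (congrArg (fun k => T'.i X (.ofAdd k)) (toK2_natural f k))))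

/-- Over a one-point scheme `X` over `L`, commutators in the extension are given by the symbols of
the cocycle. -/
lemma CentralExtension.pullback_commutator {X P : FTSch F} [Nonempty X.left] [Subsingleton X.left]
    (f : X ⟶ P) (s : torus Y F L (Fun X) → T'.E.obj.obj (op X))
    (hs : ∀ t, T'.π X (s t) = .ofAdd t) (c : torus Y F L (Fun X) → torus Y F L (Fun X) →
      MilnorK2 (Fun X))
    (hmul : ∀ t₁ t₂, s t₁ * s t₂ = s (t₁ + t₂) * T'.i X (.ofAdd (toK2 X (c t₁ t₂))))
    (e₁ e₂ : T'.E.obj.obj (op P)) (t₁ t₂ : torus Y F L (Fun P))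
    (h₁ : T'.π P e₁ = .ofAdd t₁) (h₂ : T'.π P e₂ = .ofAdd t₂) (k : MilnorK2 (Fun P))
    (hk : e₁ * e₂ * (e₂ * e₁)⁻¹ = T'.i P (.ofAdd (toK2 P k))) :
    MilnorK2.map (Fun.pullback f).toRingHom k =
      c (torusPull Y L (Fun.pullback f) t₁) (torusPull Y L (Fun.pullback f) t₂) -
        c (torusPull Y L (Fun.pullback f) t₂) (torusPull Y L (Fun.pullback f) t₁) :=
  commutator_eq_of_cocycle (T'.i X) (T'.i_injective X) (T'.central X) (toK2 X)
    (toK2_bijective X).1 s c hmul (T'.map_mul_inv_mem_range f s hs e₁ t₁ h₁)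
    (T'.map_mul_inv_mem_range f s hs e₂ t₂ h₂) (T'.map_commutator f e₁ e₂ k hk)

/-- The commutator of two elements of `T'(F)` becomes, over `L`, the difference of the symbols
given by the cocycle. -/
lemma CentralExtension.HasQuadraticForm.exists_commutator [FiniteDimensional F L]
    {T' : CentralExtension Y F L} {Q : QuadraticForm ℤ Y} (hQ : T'.HasQuadraticForm Q) :
    ∃ D : LinearMap.BilinForm ℤ Y, (∀ y, D y y = Q y) ∧
      ∀ (e₁ e₂ : T'.E.obj.obj (op (pt F))) (t₁ t₂ : TF Y F L),
        T'.π (pt F) e₁ = .ofAdd (torusBase Y F L _ t₁) →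
        T'.π (pt F) e₂ = .ofAdd (torusBase Y F L _ t₂) →
        ∃ k, e₁ * e₂ * (e₂ * e₁)⁻¹ = T'.iF k ∧
          MilnorK2.map (algebraMap F L) k =
            symbolPairing D L t₁ t₂ - symbolPairing D L t₂ t₁ := by
  obtain ⟨-, D, hD, s, hs, -, hmul⟩ := hQ
  refine ⟨D, hD, fun e₁ e₂ t₁ t₂ h₁ h₂ => ?_⟩
  -- `T(F)` is commutative, so the commutator lies in the kernel of `π`, which is `K₂(F)`.
  obtain ⟨k, hk⟩ := T'.exists_iF_eq (map_commutator_eq_one (T'.π (pt F)) e₁ e₂)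
  refine ⟨k, hk.symm, ?_⟩
  have h4 := T'.pullback_commutator (ptExtHom F L) (s _ (ptExtFun F L)) (hs _ _) _ (hmul _ _)
    e₁ e₂ _ _ h₁ h₂ _ hk.symm
  -- The identity was obtained in `K₂` of the functions on `Spec L`; it is transported to `K₂(L)`
  -- along the isomorphism `ptExtFun`.
  refine (MilnorK2.map_bijective _ (ptExtFun_bijective F L)).1 ?_
  refine Eq.trans ?_ (h4.trans ((congrArg₂ _ (symbolPairing_torusSplit _ _ _ _ _)
    (symbolPairing_torusSplit _ _ _ _ _)).trans (map_sub _ _ _).symm))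
  refine (MilnorK2.map_map _ _ k).trans (Eq.trans ?_ (MilnorK2.map_map _ _ k).symm)
  exact congrArg (fun g => MilnorK2.map g k) (RingHom.ext fun x =>
    ((ptExtFun F L).commutes x).trans ((Fun.pullback (ptExtHom F L)).commutes x).symm)

end Commutator

/-! ### The center of the tame cover -/

/-- The center of the push-forward of a central extension. -/
lemma mk_mem_center_iff {M G K : Type*} [CommGroup M] [Group G] [AddCommGroup K]
    (h : K →+ Additive M) (i : Multiplicative K →* G) (hc : i.range ≤ Subgroup.center G)
    (x : M × G) :
    (x : (M × G) ⧸ Subgroup.normalClosure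
        (Set.range fun k : K => ((h k).toMul⁻¹, i (.ofAdd k)))) ∈ Subgroup.center _ ↔
      ∀ b, ∃ k, h k = 0 ∧ x.2 * b * (b * x.2)⁻¹ = i (.ofAdd k) := by
  -- The relations form the range of a homomorphism into the center of `M × G`; this range is
  -- normal, so it equals its normal closure and congruence modulo it is explicit.
  let r : Multiplicative K →* M × G := (h.toMultiplicativeLeft⁻¹).prod i
  have hr : Set.range (fun k : K => ((h k).toMul⁻¹, i (.ofAdd k))) = (r.range : Set (M × G)) := rfl
  have hcr : r.range ≤ Subgroup.center (M × G) := by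
    rintro _ ⟨k, rfl⟩
    refine Subgroup.mem_center_iff.2 fun g => Prod.ext (mul_comm _ _) ?_
    exact Subgroup.mem_center_iff.1 (hc ⟨k, rfl⟩) g.2
  have hn : r.range.Normal := ⟨fun a ha g => by
    rwa [Subgroup.mem_center_iff.1 (hcr ha) g, mul_inv_cancel_right]⟩
  have key (y : M × G) : (x : (M × G) ⧸ Subgroup.normalClosure (r.range : Set (M × G))) * y =
      y * x ↔ ∃ k, h k = 0 ∧ x.2 * y.2 * (y.2 * x.2)⁻¹ = i (.ofAdd k) := by
    rw [← QuotientGroup.mk_mul, ← QuotientGroup.mk_mul, QuotientGroup.eq_iff_div_mem,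
      Subgroup.normalClosure_eq_self]
    constructor
    · rintro ⟨k, hk⟩
      refine ⟨k.toAdd, ?_, ?_⟩
      · have h1 : (h k.toAdd).toMul⁻¹ = x.1 * y.1 / (y.1 * x.1) := congrArg Prod.fst hk
        rw [mul_comm y.1, div_self', inv_eq_one] at h1
        exact h1
      · rw [← div_eq_mul_inv]
        exact (congrArg Prod.snd hk).symm
    · rintro ⟨k, hk, hk'⟩
      refine ⟨.ofAdd k, Prod.ext ?_ ?_⟩
      · change (h k).toMul⁻¹ = x.1 * y.1 / (y.1 * x.1)
        rw [hk, mul_comm y.1, div_self', toMul_zero, inv_one]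
      · change i (.ofAdd k) = x.2 * y.2 / (y.2 * x.2)
        rw [div_eq_mul_inv, hk']
  rw [hr, Subgroup.mem_center_iff]
  refine ⟨fun H b => ((key (1, b)).1 (H _).symm), fun H z => ?_⟩
  obtain ⟨y, rfl⟩ := QuotientGroup.mk_surjective z
  exact ((key y).2 (H y.2)).symm

section TamePairing

variable {Y : Type u} [AddCommGroup Y] {L : Type u} [Field L] [ValuativeRel L]
  [TopologicalSpace L] [IsNonarchimedeanLocalField L]

/-- The pairing `(y₁ ⊗ a, y₂ ⊗ b) ↦ B(y₁, y₂) (a, b)_tame` on `Y ⊗ L^×`. -/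
noncomputable def tamePairing (B : LinearMap.BilinForm ℤ Y) :
    TL Y L →ₗ[ℤ] TL Y L →ₗ[ℤ] Additive 𝓀[L]ˣ :=
  (TensorProduct.map₂ B (tameBilin L)).compr₂
    (TensorProduct.lid ℤ (Additive 𝓀[L]ˣ)).toLinearMap

/-- The tame symbol is antisymmetric, so the two terms add up with coefficient `D(y₁, y₂) + D(y₂,
y₁)`, the polarization of `Q`. -/
lemma tame_symbolPairing_sub (D : LinearMap.BilinForm ℤ Y) (Q : QuadraticForm ℤ Y)
    (hD : ∀ y, D y y = Q y) (s t : TL Y L) :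
    tame L (symbolPairing D L s t - symbolPairing D L t s) =
      tamePairing (QuadraticMap.polarBilin Q) s t := by
  have : ((symbolPairing D L - (symbolPairing D L).flip).compr₂ (tame L)) =
      tamePairing (QuadraticMap.polarBilin Q) := by
    refine TensorProduct.ext' fun y₁ a => TensorProduct.ext' fun y₂ b => ?_
    have h1 : tame L (symb L b a) = -tame L (symb L a b) :=
      congrArg Additive.ofMul (tameSymbol_swap a.toMul b.toMul)
    have h2 : QuadraticMap.polarBilin Q y₁ y₂ = D y₁ y₂ + D y₂ y₁ := by
      rw [QuadraticMap.polarBilin_apply_apply, QuadraticMap.polar, ← hD, ← hD, ← hD]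
      simp only [map_add, LinearMap.add_apply]
      ring
    change tame L (D y₁ y₂ • symb L a b - D y₂ y₁ • symb L b a) =
      QuadraticMap.polarBilin Q y₁ y₂ • tame L (symb L a b)
    rw [map_sub, map_zsmul, map_zsmul, h1, h2]
    have h3 {A : Type u} [AddCommGroup A] (x : A) (a b : ℤ) : a • x - b • -x = (a + b) • x := by
      rw [smul_neg, sub_neg_eq_add, add_smul]
    exact h3 _ _ _
  exact DFunLike.congr_fun (DFunLike.congr_fun this s) t

end TamePairing

section Center

variable {Y F L : Type u} [AddCommGroup Y] [Field F] [Field L] [Algebra F L]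
  [DistribMulAction (L ≃ₐ[F] L) Y]
  [ValuativeRel F] [TopologicalSpace F] [IsNonarchimedeanLocalField F]

lemma TameCover.mk_mem_center_iff (T' : CentralExtension Y F L) (n : ℕ)
    (hn : n ∣ Nat.card 𝓀[F] - 1) (x : rootsOfUnity n F × T'.E.obj.obj (op (pt F))) :
    (x : TameCover T' n hn) ∈ Subgroup.center (TameCover T' n hn) ↔
      ∀ b, ∃ k, hilbert F n hn k = 0 ∧ x.2 * b * (b * x.2)⁻¹ = T'.iF k :=
  MetaplecticTorus.mk_mem_center_iff (hilbert F n hn) T'.iFHom (by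
    rintro _ ⟨k, rfl⟩
    exact T'.central (pt F) ⟨_, rfl⟩) x

variable [ValuativeRel L] [TopologicalSpace L] [IsNonarchimedeanLocalField L]
  [FiniteDimensional F L]

/-- The elements of `Z^†(T_F)` are those that are orthogonal to `T_F` for the commutator pairing,
which is computed over `L`. -/
theorem mem_ZDagger_iff (hL : IsUnramified F L) (T' : CentralExtension Y F L)
    (Q : QuadraticForm ℤ Y) (hQ : T'.HasQuadraticForm Q) (n : ℕ)
    (hn : n ∣ Nat.card 𝓀[F] - 1) (t : TL Y L) :
    t ∈ ZDagger T' n hn ↔ t ∈ TF Y F L ∧ ∀ t' ∈ TF Y F L,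
      ((Nat.card 𝓀[F] - 1) / n) • tamePairing (QuadraticMap.polarBilin Q) t t' = 0 := by
  obtain ⟨D, hD, hcomm⟩ := hQ.exists_commutator
  have hbase := torusBase_bijective (Y := Y) (L := L) _ (algebraMap_pt_bijective F)
  constructor
  · rintro ⟨ht, z, hz, hzt⟩
    obtain ⟨x, rfl⟩ := QuotientGroup.mk_surjective z
    refine ⟨ht, fun t' ht' => ?_⟩
    obtain ⟨e', he'⟩ := T'.π_surjective (pt F) (.ofAdd (torusBase Y F L _ ⟨t', ht'⟩))
    obtain ⟨k, hk0, hk⟩ := (TameCover.mk_mem_center_iff T' n hn x).1 hz e'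
    obtain ⟨k', hk', hk''⟩ := hcomm x.2 e' ⟨t, ht⟩ ⟨t', ht'⟩ hzt he'
    -- Centrality and the cocycle computation each provide an element of `K₂(F)` representing the
    -- commutator; `K₂(F)` embeds in `T'(F)`.
    obtain rfl : k = k' := T'.iF_injective (hk.symm.trans hk')
    rw [hL.hilbert_eq_zero_iff, hk'', tame_symbolPairing_sub D Q hD] at hk0
    exact hk0
  · rintro ⟨ht, h⟩
    obtain ⟨e, he⟩ := T'.π_surjective (pt F) (.ofAdd (torusBase Y F L _ ⟨t, ht⟩))
    refine ⟨ht, QuotientGroup.mk (1, e), (TameCover.mk_mem_center_iff T' n hn (1, e)).2 ?_, he⟩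
    intro e'
    obtain ⟨t', ht'⟩ := hbase.2 (T'.π (pt F) e').toAdd
    obtain ⟨k, hk, hk'⟩ := hcomm e e' ⟨t, ht⟩ t' he (congrArg Multiplicative.ofAdd ht').symm
    refine ⟨k, ?_, hk⟩
    rw [hL.hilbert_eq_zero_iff, hk', tame_symbolPairing_sub D Q hD]
    exact h t' t'.2

end Center

/-! ### Valuation and angular component on `Y ⊗ L^×` -/

section Decomposition

variable {Y : Type u} [AddCommGroup Y]

/-- The map `Y → Hom(Y ⊗ A, A)`, `y' ↦ (y ⊗ x ↦ B(y', y) x)`. -/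
noncomputable def evalPairing (B : LinearMap.BilinForm ℤ Y) (A : Type u) [AddCommGroup A] :
    Y →ₗ[ℤ] Y ⊗[ℤ] A →ₗ[ℤ] A :=
  ((LinearMap.rTensorHom A).comp B).compr₂ (TensorProduct.lid ℤ A).toLinearMap

lemma evalPairing_tmul (B : LinearMap.BilinForm ℤ Y) {A : Type u} [AddCommGroup A] (y' y : Y)
    (x : A) : evalPairing B A y' (y ⊗ₜ x) = B y' y • x := rfl

lemma exists_tmul_eq_of_forall_mem_zpowers {A : Type u} [CommGroup A] {θ : A}
    (hθ : ∀ x, x ∈ Subgroup.zpowers θ) (t : Y ⊗[ℤ] Additive A) :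
    ∃ y, t = y ⊗ₜ .ofMul θ := by
  induction t with
  | zero => exact ⟨0, (TensorProduct.zero_tmul _ _).symm⟩
  | tmul y x =>
    obtain ⟨k, hk⟩ := hθ x.toMul
    refine ⟨k • y, ?_⟩
    rw [TensorProduct.smul_tmul, ← ofMul_zpow]
    exact congrArg (fun z => y ⊗ₜ[ℤ] Additive.ofMul z) hk.symm
  | add s t hs ht =>
    obtain ⟨y, rfl⟩ := hs
    obtain ⟨y', rfl⟩ := ht
    exact ⟨y + y', (TensorProduct.add_tmul _ _ _).symm⟩

/-- In a basis of `Y` the group `Y ⊗ A` is a power of `A`, and the coordinates of `y ⊗ θ` are the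
powers `θ ^ yᵢ`. -/
lemma exists_eq_smul_of_tmul_eq_zero [Module.Free ℤ Y] [Module.Finite ℤ Y] {A : Type u}
    [CommGroup A] {θ : A} {y : Y} (h : y ⊗ₜ[ℤ] Additive.ofMul θ = 0) :
    ∃ w, y = (orderOf θ : ℤ) • w := by
  let b := Module.Free.chooseBasis ℤ Y
  have hdvd (i) : (orderOf θ : ℤ) ∣ b.repr y i := by
    have h1 := congrArg ((TensorProduct.lid ℤ (Additive A)).toLinearMap.comp
      ((b.coord i).rTensor (Additive A))) h
    rw [map_zero] at h1
    rw [orderOf_dvd_iff_zpow_eq_one]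
    exact h1
  choose c hc using hdvd
  refine ⟨∑ i, c i • b i, ?_⟩
  rw [Finset.smul_sum]
  conv_lhs => rw [← b.sum_repr y]
  exact Finset.sum_congr rfl fun i _ => by rw [hc, mul_smul]

variable {L : Type u} [Field L] [ValuativeRel L] [TopologicalSpace L]
  [IsNonarchimedeanLocalField L]

/-- The map `Y ⊗ L^× → Y`, `y ⊗ a ↦ v(a) y`. -/
noncomputable def valMap : TL Y L →ₗ[ℤ] Y :=
  (TensorProduct.rid ℤ Y).toLinearMap.comp
    ((MonoidHom.toAdditiveLeft (ord L)).toIntLinearMap.lTensor Y)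

lemma valMap_tmul (y : Y) (a : Lˣ) :
    valMap (y ⊗ₜ[ℤ] Additive.ofMul a) = (ord L a).toAdd • y := rfl

variable {ϖ : Lˣ} (hϖ : ord L ϖ = .ofAdd 1)

/-- The map `Y ⊗ L^× → Y ⊗ 𝔩^×` given by the angular component. -/
noncomputable def angMap : TL Y L →ₗ[ℤ] Y ⊗[ℤ] Additive 𝓀[L]ˣ :=
  (angular ϖ hϖ).toAdditive.toIntLinearMap.lTensor Y

lemma angMap_tmul (y : Y) (a : Lˣ) :
    angMap hϖ (y ⊗ₜ[ℤ] Additive.ofMul a) = y ⊗ₜ .ofMul (angular ϖ hϖ a) := rfl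

lemma valMap_uniformizer (y : Y) (h : ord L ϖ = .ofAdd 1) : valMap (cochar ϖ y) = y := by
  change valMap (y ⊗ₜ[ℤ] Additive.ofMul ϖ) = y
  rw [valMap_tmul, h, toAdd_ofAdd, one_smul]

lemma angMap_uniformizer (y : Y) : angMap hϖ (cochar ϖ y) = 0 := by
  change angMap hϖ (y ⊗ₜ[ℤ] Additive.ofMul ϖ) = 0
  rw [angMap_tmul, angular_self, ofMul_one, TensorProduct.tmul_zero]

lemma valMap_teich (y : Y) (θ : 𝓀[L]ˣ) : valMap (cochar (teich θ) y) = 0 := by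
  change valMap (y ⊗ₜ[ℤ] Additive.ofMul (teich θ)) = 0
  rw [valMap_tmul, teich, MonoidHom.mem_ker.1 (inclUnit_mem_ker _), toAdd_one, zero_smul]

lemma angMap_teich (y : Y) (θ : 𝓀[L]ˣ) :
    angMap hϖ (cochar (teich θ) y) = y ⊗ₜ .ofMul θ := by
  change angMap hϖ (y ⊗ₜ[ℤ] Additive.ofMul (teich θ)) = _
  rw [angMap_tmul, angular_teich]

lemma valMap_of_mem_TL1 {t : TL Y L} (ht : t ∈ TL1 L Y) : valMap t = 0 := by
  obtain ⟨u, -, rfl⟩ := ht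
  have : valMap.comp (TensorProduct.map (LinearMap.id : Y →ₗ[ℤ] Y)
      (inclUnit L).toAdditive.toIntLinearMap) = 0 := by
    refine TensorProduct.ext' fun y a => ?_
    change (ord L (inclUnit L a.toMul)).toAdd • y = 0
    rw [MonoidHom.mem_ker.1 (inclUnit_mem_ker _), toAdd_one, zero_smul]
  exact DFunLike.congr_fun this u

lemma angMap_of_mem_TL1 {t : TL Y L} (ht : t ∈ TL1 L Y) : angMap hϖ t = 0 := by
  obtain ⟨u, hu, rfl⟩ := ht
  have : (angMap hϖ).comp (TensorProduct.map (LinearMap.id : Y →ₗ[ℤ] Y)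
      (inclUnit L).toAdditive.toIntLinearMap) =
      TensorProduct.map (LinearMap.id : Y →ₗ[ℤ] Y) (redUnit L).toAdditive.toIntLinearMap := by
    refine TensorProduct.ext' fun y a => ?_
    change y ⊗ₜ[ℤ] Additive.ofMul (angular ϖ hϖ (inclUnit L a.toMul)) = _
    rw [angular_inclUnit]
    rfl
  exact (DFunLike.congr_fun this u).trans hu

/-- The tame pairing in terms of valuations and angular components. -/
lemma tamePairing_eq (B : LinearMap.BilinForm ℤ Y) (hB : ∀ y y', B y y' = B y' y) (s t : TL Y L) :
    tamePairing B s t = B (valMap s) (valMap t) • Additive.ofMul (-1) +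
      evalPairing B _ (valMap t) (angMap hϖ s) - evalPairing B _ (valMap s) (angMap hϖ t) := by
  have : tamePairing B = (B.compl₁₂ valMap valMap).compr₂
        (LinearMap.toSpanSingleton ℤ (Additive 𝓀[L]ˣ) (.ofMul (-1))) +
      ((evalPairing B _).compl₁₂ valMap (angMap hϖ)).flip -
        (evalPairing B _).compl₁₂ valMap (angMap hϖ) := by
    refine TensorProduct.ext' fun y a => TensorProduct.ext' fun y' b => ?_
    change B y y' • Additive.ofMul (tameSymbol a.toMul b.toMul) =
      B ((ord L a.toMul).toAdd • y) ((ord L b.toMul).toAdd • y') • Additive.ofMul (-1) +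
        B ((ord L b.toMul).toAdd • y') y • Additive.ofMul (angular ϖ hϖ a.toMul) -
        B ((ord L a.toMul).toAdd • y) y' • Additive.ofMul (angular ϖ hϖ b.toMul)
    rw [tameSymbol_eq_angular hϖ, ofMul_mul, ofMul_mul, ofMul_zpow, ofMul_zpow, ofMul_zpow]
    simp only [map_smul, LinearMap.smul_apply, smul_eq_mul, hB y' y]
    generalize Additive.ofMul (angular ϖ hϖ a.toMul) = x
    generalize Additive.ofMul (angular ϖ hϖ b.toMul) = x'
    generalize Additive.ofMul (-1 : 𝓀[L]ˣ) = x''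
    have h {A : Type u} [AddCommGroup A] (x x' x'' : A) (c i j : ℤ) :
        c • ((i * j) • x'' + j • x + -i • x') =
          (i * (j * c)) • x'' + (j * c) • x - (i * c) • x' := by module
    exact (h x x' x'' _ _ _).trans (by ring_nf)
  exact DFunLike.congr_fun (DFunLike.congr_fun this s) t

lemma tamePairing_eq_of_angMap {B : LinearMap.BilinForm ℤ Y} (hB : ∀ y y', B y y' = B y' y)
    {s t : TL Y L} {y₂ y₂' : Y} {θ : 𝓀[L]ˣ} (hs : angMap hϖ s = y₂ ⊗ₜ .ofMul θ)
    (ht : angMap hϖ t = y₂' ⊗ₜ .ofMul θ) :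
    tamePairing B s t = .ofMul ((-1) ^ B (valMap s) (valMap t) *
      θ ^ (B y₂ (valMap t) - B y₂' (valMap s))) := by
  rw [tamePairing_eq hϖ B hB, hs, ht, evalPairing_tmul, evalPairing_tmul, hB _ y₂, hB _ y₂',
    zpow_sub, ← mul_assoc]
  rfl

end Decomposition

/-! ### The Frobenius automorphism -/

section Frobenius

variable {L : Type u} [Field L] [ValuativeRel L] [TopologicalSpace L]
  [IsNonarchimedeanLocalField L] {γ : L →+* L} {q : ℕ}

/-- Ultrametric inequality for `γ x = (γ x - x ^ q) + x ^ q`. The congruence `hγ` alone thus makes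
`γ` preserve the integers. -/
lemma valuation_frob_le_one {L : Type u} [Field L] [ValuativeRel L] {γ : L →+* L} {q : ℕ}
    (hγ : ∀ x : 𝒪[L], valuation L (γ (x : L) - (x : L) ^ q) < 1)
    {x : L} (hx : valuation L x ≤ 1) : valuation L (γ x) ≤ 1 := by
  have h := Valuation.map_add (valuation L) (γ x - x ^ q) (x ^ q)
  rw [sub_add_cancel] at h
  refine h.trans (max_le (hγ ⟨x, hx⟩).le ?_)
  rw [map_pow]
  exact pow_le_one₀ zero_le hx

lemma frob_mem_ker (hγ : ∀ x : 𝒪[L], valuation L (γ (x : L) - (x : L) ^ q) < 1)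
    {x : Lˣ} (hx : x ∈ (ord L).ker) :
    Units.map (γ : L →* L) x ∈ (ord L).ker := by
  have h (y : Lˣ) (hy : y ∈ (ord L).ker) : 0 ≤ (ord L (Units.map (γ : L →* L) y)).toAdd :=
    (ord_nonneg_iff _).2 (valuation_frob_le_one hγ (valuation_eq_one hy).le)
  have h1 := h x hx
  have h2 := h x⁻¹ (inv_mem hx)
  rw [map_inv, map_inv, toAdd_inv] at h2
  exact Multiplicative.toAdd.injective (le_antisymm (by simpa using h2) h1)

lemma resUnit_frob (hγ : ∀ x : 𝒪[L], valuation L (γ (x : L) - (x : L) ^ q) < 1)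
    (x : (ord L).ker) :
    resUnit L ⟨Units.map (γ : L →* L) x, frob_mem_ker hγ x.2⟩ = resUnit L x ^ q := by
  apply Units.ext
  change IsLocalRing.residue 𝒪[L] _ = (IsLocalRing.residue 𝒪[L] _) ^ q
  rw [← map_pow, ← sub_eq_zero, ← map_sub,
    IsLocalRing.residue_eq_zero_iff, IsLocalRing.mem_maximalIdeal, mem_nonunits_iff,
    Valuation.Integer.not_isUnit_iff_valuation_lt_one]
  exact hγ (intUnit L x : 𝒪[L])

/-- Each `a` is a unit times a power of `ϖ`; `γ` fixes `ϖ` and preserves units. -/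
lemma ord_frob (hγ : ∀ x : 𝒪[L], valuation L (γ (x : L) - (x : L) ^ q) < 1) {ϖ : Lˣ}
    (hϖ : ord L ϖ = .ofAdd 1) (hγϖ : Units.map (γ : L →* L) ϖ = ϖ)
    (a : Lˣ) : ord L (Units.map (γ : L →* L) a) = ord L a := by
  have h0 : a * ϖ ^ (-(ord L a).toAdd) ∈ (ord L).ker := by
    rw [MonoidHom.mem_ker, map_mul, map_zpow, hϖ, ← ofAdd_zsmul, smul_eq_mul, mul_one, ofAdd_neg,
      ofAdd_toAdd, mul_inv_cancel]
  have h1 := MonoidHom.mem_ker.1 (frob_mem_ker hγ h0)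
  rw [map_mul, map_zpow, hγϖ, map_mul] at h1
  rw [MonoidHom.mem_ker, map_mul] at h0
  exact mul_right_cancel (h1.trans h0.symm)

lemma angular_frob (hγ : ∀ x : 𝒪[L], valuation L (γ (x : L) - (x : L) ^ q) < 1) {ϖ : Lˣ}
    (hϖ : ord L ϖ = .ofAdd 1) (hγϖ : Units.map (γ : L →* L) ϖ = ϖ)
    (a : Lˣ) :
    angular ϖ hϖ (Units.map (γ : L →* L) a) = angular ϖ hϖ a ^ q := by
  refine Eq.trans (congrArg (resUnit L) (Subtype.ext ?_)) (resUnit_frob hγ _)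
  simp only [ord_frob hγ hϖ hγϖ, map_mul, map_zpow, hγϖ]

/-- Both sides are roots of unity of order dividing `|𝔩| - 1` with the same reduction, so uniqueness
of Teichmüller lifts applies. -/
lemma frob_teich (hγ : ∀ x : 𝒪[L], valuation L (γ (x : L) - (x : L) ^ q) < 1)
    (θ : 𝓀[L]ˣ) : Units.map (γ : L →* L) (teich θ) = teich θ ^ q := by
  have hpow : teich θ ^ (Nat.card 𝓀[L] - 1) = 1 := by
    rw [teich, ← map_pow, ← map_pow, pow_card_sub_one, map_one, map_one]
  have hmem : teich θ ∈ (ord L).ker := inclUnit_mem_ker _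
  set x : (ord L).ker := ⟨Units.map (γ : L →* L) (teich θ), frob_mem_ker hγ hmem⟩ with hx
  have hx1 : intUnit L x = intUnit L ((⟨teich θ, hmem⟩ : (ord L).ker) ^ q) := by
    refine teichmuller_unique ?_ ?_ ?_
    · rw [← map_pow, ← map_one (intUnit L)]
      exact congrArg _ (Subtype.ext (by
        change Units.map (γ : L →* L) (teich θ) ^ _ = 1
        rw [← map_pow, hpow, map_one]))
    · rw [← map_pow, ← map_one (intUnit L)]
      exact congrArg _ (Subtype.ext (by
        change (teich θ ^ q) ^ _ = 1
        rw [pow_right_comm, hpow, one_pow]))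
    · exact (resUnit_frob hγ ⟨teich θ, hmem⟩).trans (map_pow (resUnit L) _ q).symm
  exact Units.ext (congrArg (fun u : 𝒪[L]ˣ => ((u : 𝒪[L]) : L)) hx1)

end Frobenius

/-! ### Invariants of a cyclic Galois group -/

section Galois

variable {Y F L : Type u} [AddCommGroup Y] [Field F] [Field L] [Algebra F L]
  [DistribMulAction (L ≃ₐ[F] L) Y]

/-- The action of the Galois group on `Y ⊗ L^×`. -/
noncomputable def galAct (σ : L ≃ₐ[F] L) : TL Y L →ₗ[ℤ] TL Y L :=
  cocharMap (DistribSMul.toAddMonoidHom Y σ) (σ : L →ₐ[F] L).toRingHom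

lemma galAct_tmul (σ : L ≃ₐ[F] L) (y : Y) (a : Lˣ) :
    galAct σ (y ⊗ₜ[ℤ] Additive.ofMul a) =
      (σ • y) ⊗ₜ .ofMul (Units.map ((σ : L →ₐ[F] L).toRingHom : L →* L) a) := rfl

lemma galAct_mul (σ τ : L ≃ₐ[F] L) (t : TL Y L) :
    galAct (σ * τ) t = galAct σ (galAct τ t) := by
  have : galAct (Y := Y) (σ * τ) = (galAct σ).comp (galAct τ) := by
    refine TensorProduct.ext' fun y a => ?_
    change ((σ * τ) • y) ⊗ₜ[ℤ] _ = (σ • τ • y) ⊗ₜ[ℤ] _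
    rw [mul_smul]
    rfl
  exact DFunLike.congr_fun this t

lemma galAct_one (t : TL Y L) : galAct (1 : L ≃ₐ[F] L) t = t := by
  have : galAct (Y := Y) (1 : L ≃ₐ[F] L) = LinearMap.id := by
    refine TensorProduct.ext' fun y a => ?_
    change ((1 : L ≃ₐ[F] L) • y) ⊗ₜ[ℤ] _ = y ⊗ₜ[ℤ] a
    rw [one_smul]
    rfl
  exact DFunLike.congr_fun this t

lemma mem_TF_iff {γ : L ≃ₐ[F] L} (hγ : ∀ σ, σ ∈ Subgroup.zpowers γ) {t : TL Y L} :
    t ∈ TF Y F L ↔ galAct γ t = t := by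
  refine ⟨fun h => h γ, fun h σ => ?_⟩
  let H : Subgroup (L ≃ₐ[F] L) :=
    { carrier := {σ | galAct σ t = t}
      one_mem' := galAct_one t
      mul_mem' := fun {σ τ} hσ hτ => by
        change galAct (σ * τ) t = t
        rw [galAct_mul, show galAct τ t = t from hτ, show galAct σ t = t from hσ]
      inv_mem' := fun {σ} hσ => by
        change galAct σ⁻¹ t = t
        conv_lhs => rw [← show galAct σ t = t from hσ]
        rw [← galAct_mul, inv_mul_cancel, galAct_one] }
  exact (Subgroup.zpowers_le (H := H)).2 h (hγ σ)

lemma mem_invariants_iff {Γ : Type u} [Group Γ] [DistribMulAction Γ Y] {γ : Γ}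
    (hγ : ∀ σ, σ ∈ Subgroup.zpowers γ) {y : Y} : y ∈ invariants Γ Y ↔ γ • y = y :=
  ⟨fun h => h γ, fun h σ => (Subgroup.zpowers_le (H := MulAction.stabilizer Γ y)).2 h (hγ σ)⟩

end Galois

/-! ### The twisted norm -/

section Lattice

variable {Γ Y : Type u} [Group Γ] [AddCommGroup Y] [DistribMulAction Γ Y]

/-- The action of an element of `Γ`, as a linear endomorphism. -/
def smulEnd (Y : Type u) [AddCommGroup Y] [DistribMulAction Γ Y] (γ : Γ) : Module.End ℤ Y :=
  (DistribSMul.toAddMonoidHom Y γ).toIntLinearMap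

lemma smulEnd_apply (γ : Γ) (y : Y) : smulEnd Y γ y = γ • y := rfl

lemma smulEnd_pow_apply (γ : Γ) (k : ℕ) (y : Y) : (smulEnd Y γ ^ k) y = γ ^ k • y := by
  induction k with
  | zero => rw [pow_zero, pow_zero, Module.End.one_apply, one_smul]
  | succ k ih => rw [pow_succ', pow_succ', Module.End.mul_apply, ih, mul_smul, smulEnd_apply]

lemma smulEnd_pow_eq_one {γ : Γ} {d : ℕ} (hd : γ ^ d = 1) : smulEnd Y γ ^ d = 1 :=
  LinearMap.ext fun y => by rw [smulEnd_pow_apply, hd, one_smul, Module.End.one_apply]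

/-- The operator `∑ (q γ)^i` over `i < d`. -/
def twistedNorm (Y : Type u) [AddCommGroup Y] [DistribMulAction Γ Y] (γ : Γ) (q : ℤ) (d : ℕ) :
    Module.End ℤ Y :=
  ∑ i ∈ Finset.range d, (q • smulEnd Y γ) ^ i

variable {γ : Γ} {q : ℤ} {d : ℕ}

/-- Geometric sum: `(qγ - 1) ∑ (qγ)^i = (qγ)^d - 1 = q^d - 1`. Thus every multiple of `q^d - 1` lies
in the image of `δ_q`, with explicit preimage. -/
lemma smul_twistedNorm (hd : γ ^ d = 1) (w : Y) :
    q • (γ • twistedNorm Y γ q d w) - twistedNorm Y γ q d w = (q ^ d - 1) • w := by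
  have h := mul_geom_sum (q • smulEnd Y γ) d
  rw [smul_pow, smulEnd_pow_eq_one hd] at h
  have h1 := DFunLike.congr_fun h w
  rw [sub_smul, one_smul]
  exact h1

lemma twistedNorm_smul (hd : γ ^ d = 1) (y : Y) :
    twistedNorm Y γ q d (q • (γ • y) - y) = (q ^ d - 1) • y := by
  have h := geom_sum_mul (q • smulEnd Y γ) d
  rw [smul_pow, smulEnd_pow_eq_one hd] at h
  have h1 := DFunLike.congr_fun h y
  rw [sub_smul, one_smul]
  exact h1

/-- Applying the twisted norm to both sides multiplies each candidate for `y` by `q^d - 1`, which is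
cancelled because `Y` is torsion-free. -/
lemma eq_twistedNorm [Module.IsTorsionFree ℤ Y] (hd : γ ^ d = 1) (hq : q ^ d - 1 ≠ 0) {y w : Y}
    (h : q • (γ • y) - y = (q ^ d - 1) • w) : y = twistedNorm Y γ q d w := by
  have h1 := twistedNorm_smul (q := q) hd y
  rw [h, map_smul] at h1
  exact (smul_right_injective Y hq h1).symm

variable {Q : QuadraticForm ℤ Y}

lemma polar_smul_smul (hQ : ∀ (σ : Γ) (y : Y), Q (σ • y) = Q y) (σ : Γ) (y y' : Y) :
    QuadraticMap.polar Q (σ • y) (σ • y') = QuadraticMap.polar Q y y' := by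
  rw [QuadraticMap.polar, ← smul_add, hQ, hQ, hQ, QuadraticMap.polar]

/-- If `(q γ - 1) y = N w` then `(q - 1) B(y, x) = N B(w, x)` for invariant `x`. -/
lemma sub_one_mul_polar (hQ : ∀ (σ : Γ) (y : Y), Q (σ • y) = Q y) {x y w : Y} {N : ℤ}
    (hx : γ • x = x) (h : q • (γ • y) - y = N • w) :
    (q - 1) * QuadraticMap.polar Q y x = N * QuadraticMap.polar Q w x := by
  -- Invariance of `x` and of `Q` makes `B(·, x)` insensitive to `γ`, so `qγ - 1` acts through it as
  -- `q - 1`.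
  have h1 : QuadraticMap.polar Q (γ • y) x = QuadraticMap.polar Q y x := by
    conv_lhs => rw [← hx]
    exact polar_smul_smul hQ γ y x
  have h2 := congrArg (QuadraticMap.polar Q · x) h
  simp only [QuadraticMap.polar_sub_left, QuadraticMap.polar_smul_left, h1, smul_eq_mul] at h2
  rw [← h2]
  ring

/-- Shifting the index cyclically shows invariance under `γ⁻¹`. Inverses are used because `γ^i`
passes to the other side of `B` as its inverse. -/
lemma smul_sum_inv_smul (hd : γ ^ d = 1) (z : Y) :
    γ • ∑ i ∈ Finset.range d, (γ ^ i)⁻¹ • z = ∑ i ∈ Finset.range d, (γ ^ i)⁻¹ • z := by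
  have h1 : γ⁻¹ • ∑ i ∈ Finset.range d, (γ ^ i)⁻¹ • z = ∑ i ∈ Finset.range d, (γ ^ i)⁻¹ • z := by
    rw [Finset.smul_sum]
    have h2 := Finset.sum_range_succ' (fun i => (γ ^ i)⁻¹ • z) d
    rw [Finset.sum_range_succ, hd, pow_zero, add_left_inj] at h2
    rw [h2]
    exact Finset.sum_congr rfl fun i _ => by rw [smul_smul, pow_succ, mul_inv_rev]
  conv_lhs => rw [← h1]
  rw [smul_inv_smul]

lemma twistedNorm_apply (w : Y) :
    twistedNorm Y γ q d w = ∑ i ∈ Finset.range d, q ^ i • (γ ^ i • w) := by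
  rw [twistedNorm, LinearMap.sum_apply]
  refine Finset.sum_congr rfl fun i _ => ?_
  rw [smul_pow, LinearMap.smul_apply, smulEnd_pow_apply]

/-- Modulo `n` the powers of `q` become `1`, so `B(∑ q^i γ^i w, z) ≡ B(w, ∑ γ^(-i) z)`, and the
second argument is `Γ`-invariant. -/
lemma twistedNorm_mem_sharp (hQ : ∀ (σ : Γ) (y : Y), Q (σ • y) = Q y)
    (hγ : ∀ σ, σ ∈ Subgroup.zpowers γ) (hd : γ ^ d = 1) {n : ℕ} (hn : (n : ℤ) ∣ q - 1) {w : Y}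
    (hw : w ∈ sharp Q n (invariants Γ Y)) : twistedNorm Y γ q d w ∈ sharp Q n ⊤ := by
  intro z _
  have h1 := hw _ ((mem_invariants_iff hγ).2 (smul_sum_inv_smul hd z))
  have hsum : ∀ (f : ℕ → Y) (x : Y), QuadraticMap.polar Q (∑ i ∈ Finset.range d, f i) x =
      ∑ i ∈ Finset.range d, QuadraticMap.polar Q (f i) x := fun f x =>
    map_sum ((QuadraticMap.polarBilin Q).flip x) f _
  have hsum' : ∀ (f : ℕ → Y) (x : Y), QuadraticMap.polar Q x (∑ i ∈ Finset.range d, f i) =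
      ∑ i ∈ Finset.range d, QuadraticMap.polar Q x (f i) := fun f x =>
    map_sum (QuadraticMap.polarBilin Q x) f _
  rw [twistedNorm_apply, hsum]
  rw [hsum'] at h1
  refine (dvd_iff_dvd_of_dvd_sub ?_).2 h1
  rw [← Finset.sum_sub_distrib]
  refine Finset.dvd_sum fun i _ => ?_
  have h2 : QuadraticMap.polar Q w ((γ ^ i)⁻¹ • z) = QuadraticMap.polar Q (γ ^ i • w) z := by
    rw [← polar_smul_smul hQ (γ ^ i) w, smul_inv_smul]
  rw [QuadraticMap.polar_smul_left, h2, smul_eq_mul, ← sub_one_mul]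
  exact (hn.trans (sub_one_dvd_pow_sub_one q i)).mul_right _

end Lattice

lemma tmul_ofMul_zpow {Y A : Type u} [AddCommGroup Y] [CommGroup A] (y : Y) (a : A) (k : ℤ) :
    y ⊗ₜ[ℤ] Additive.ofMul (a ^ k) = (k • y) ⊗ₜ .ofMul a :=
  (TensorProduct.smul_tmul k y (Additive.ofMul a)).symm

/-! ### The Frobenius action on `T_L`, and membership in `T_F` -/

section FrobeniusTorus

variable {Y F L : Type u} [AddCommGroup Y] [Field F] [Field L] [Algebra F L]
  [DistribMulAction (L ≃ₐ[F] L) Y] {γ : L ≃ₐ[F] L}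

lemma cochar_uniformizer_mem_TF (hγ : ∀ σ : L ≃ₐ[F] L, σ ∈ Subgroup.zpowers γ) {ϖ : Lˣ}
    (hγϖ : Units.map ((γ : L →ₐ[F] L).toRingHom : L →* L) ϖ = ϖ) {y : Y}
    (hy : y ∈ invariants (L ≃ₐ[F] L) Y) : cochar ϖ y ∈ TF Y F L := by
  rw [mem_TF_iff hγ]
  change galAct γ (y ⊗ₜ[ℤ] Additive.ofMul ϖ) = y ⊗ₜ[ℤ] Additive.ofMul ϖ
  rw [galAct_tmul, hγϖ, hy γ]

variable [ValuativeRel L] [TopologicalSpace L] [IsNonarchimedeanLocalField L] {q : ℕ}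

lemma valMap_galAct (hγq : ∀ x : 𝒪[L], valuation L (γ (x : L) - (x : L) ^ q) < 1) {ϖ : Lˣ}
    (hϖ : ord L ϖ = .ofAdd 1)
    (hγϖ : Units.map ((γ : L →ₐ[F] L).toRingHom : L →* L) ϖ = ϖ) (t : TL Y L) :
    valMap (galAct γ t) = γ • valMap t := by
  have : valMap.comp (galAct (Y := Y) γ) = (smulEnd Y γ).comp valMap := by
    refine TensorProduct.ext' fun y a => ?_
    change (ord L (Units.map ((γ : L →ₐ[F] L).toRingHom : L →* L) a.toMul)).toAdd • (γ • y) =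
      smulEnd Y γ ((ord L a.toMul).toAdd • y)
    rw [ord_frob (γ := (γ : L →ₐ[F] L).toRingHom) hγq hϖ hγϖ, map_smul]
    rfl
  exact DFunLike.congr_fun this t

/-- Frobenius is the `q`-th power on `𝔩^×`, and this power moves across the tensor sign to `Y`; this
is the origin of `δ_q = qγ - 1`. -/
lemma angMap_galAct (hγq : ∀ x : 𝒪[L], valuation L (γ (x : L) - (x : L) ^ q) < 1) {ϖ : Lˣ}
    (hϖ : ord L ϖ = .ofAdd 1)
    (hγϖ : Units.map ((γ : L →ₐ[F] L).toRingHom : L →* L) ϖ = ϖ) (t : TL Y L) :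
    angMap hϖ (galAct γ t) = ((q : ℤ) • smulEnd Y γ).rTensor _ (angMap hϖ t) := by
  have : (angMap hϖ).comp (galAct (Y := Y) γ) =
      (((q : ℤ) • smulEnd Y γ).rTensor _).comp (angMap hϖ) := by
    refine TensorProduct.ext' fun y a => ?_
    change (γ • y) ⊗ₜ[ℤ] Additive.ofMul (angular ϖ hϖ
        (Units.map ((γ : L →ₐ[F] L).toRingHom : L →* L) a.toMul)) =
      ((q : ℤ) • (γ • y)) ⊗ₜ[ℤ] Additive.ofMul (angular ϖ hϖ a.toMul)
    rw [angular_frob (γ := (γ : L →ₐ[F] L).toRingHom) hγq hϖ hγϖ, ← zpow_natCast,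
      tmul_ofMul_zpow]
  exact DFunLike.congr_fun this t

/-- With `ϑ = teich θ`: `γ (y ⊗ ϑ) = γy ⊗ ϑ^q = qγy ⊗ ϑ = y ⊗ ϑ + w ⊗ ϑ^N`, and the last term
vanishes. -/
lemma cochar_teich_mem_TF (hγ : ∀ σ : L ≃ₐ[F] L, σ ∈ Subgroup.zpowers γ)
    (hγq : ∀ x : 𝒪[L], valuation L (γ (x : L) - (x : L) ^ q) < 1) {θ : 𝓀[L]ˣ} {N : ℤ}
    (hN : teich θ ^ N = 1) {y w : Y} (hy : (q : ℤ) • (γ • y) - y = N • w) :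
    cochar (teich θ) y ∈ TF Y F L := by
  rw [mem_TF_iff hγ]
  change galAct γ (y ⊗ₜ[ℤ] Additive.ofMul (teich θ)) = y ⊗ₜ[ℤ] Additive.ofMul (teich θ)
  rw [galAct_tmul, frob_teich (γ := (γ : L →ₐ[F] L).toRingHom) hγq, ← zpow_natCast,
    tmul_ofMul_zpow, sub_eq_iff_eq_add.1 hy, TensorProduct.add_tmul, ← tmul_ofMul_zpow, hN, ofMul_one, TensorProduct.tmul_zero, zero_add]

lemma valMap_mem_invariants (hγ : ∀ σ : L ≃ₐ[F] L, σ ∈ Subgroup.zpowers γ)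
    (hγq : ∀ x : 𝒪[L], valuation L (γ (x : L) - (x : L) ^ q) < 1) {ϖ : Lˣ}
    (hϖ : ord L ϖ = .ofAdd 1)
    (hγϖ : Units.map ((γ : L →ₐ[F] L).toRingHom : L →* L) ϖ = ϖ) {t : TL Y L}
    (ht : t ∈ TF Y F L) : valMap t ∈ invariants (L ≃ₐ[F] L) Y := by
  rw [mem_invariants_iff hγ, ← valMap_galAct hγq hϖ hγϖ, (mem_TF_iff hγ).1 ht]

/-- Invariance of `t` forces `(δ_q y) ⊗ θ = 0` in `Y ⊗ 𝔩^×`, and freeness of `Y` turns this into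
divisibility. -/
lemma exists_of_angMap_eq [Module.Free ℤ Y] [Module.Finite ℤ Y]
    (hγ : ∀ σ : L ≃ₐ[F] L, σ ∈ Subgroup.zpowers γ)
    (hγq : ∀ x : 𝒪[L], valuation L (γ (x : L) - (x : L) ^ q) < 1) {ϖ : Lˣ}
    (hϖ : ord L ϖ = .ofAdd 1)
    (hγϖ : Units.map ((γ : L →ₐ[F] L).toRingHom : L →* L) ϖ = ϖ) {t : TL Y L}
    (ht : t ∈ TF Y F L) {y : Y} {θ : 𝓀[L]ˣ} (hy : angMap hϖ t = y ⊗ₜ .ofMul θ) :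
    ∃ w, (q : ℤ) • (γ • y) - y = (orderOf θ : ℤ) • w := by
  apply exists_eq_smul_of_tmul_eq_zero
  have h := angMap_galAct hγq hϖ hγϖ t
  rw [(mem_TF_iff hγ).1 ht, hy, LinearMap.rTensor_tmul] at h
  rw [TensorProduct.sub_tmul, sub_eq_zero]
  exact h.symm

end FrobeniusTorus

/-! ### The main theorem -/

/-- `-1` comes from `𝔣^×`, a group of order `q - 1`; this treats even and odd `q` alike. -/
lemma neg_one_pow_card_sub_one {F L : Type u} [Field F] [ValuativeRel F] [TopologicalSpace F]
    [IsNonarchimedeanLocalField F] [Field L] [ValuativeRel L] [TopologicalSpace L]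
    [IsNonarchimedeanLocalField L] [Algebra F L] (hL : IsUnramified F L) :
    (-1 : 𝓀[L]ˣ) ^ (Nat.card 𝓀[F] - 1) = 1 := by
  have h : Units.map (hL.resMap : 𝓀[F] →* 𝓀[L]) (-1) = -1 := Units.ext (by simp)
  rw [← h, ← map_pow, pow_card_sub_one, map_one]

lemma orderOf_eq_of_isUnramified {F L : Type u} [Field F] [ValuativeRel F] [TopologicalSpace F]
    [IsNonarchimedeanLocalField F] [Field L] [ValuativeRel L] [TopologicalSpace L]
    [IsNonarchimedeanLocalField L] [Algebra F L] (hL : IsUnramified F L) {θ : 𝓀[L]ˣ}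
    (hθ : ∀ x : 𝓀[L]ˣ, x ∈ Subgroup.zpowers θ) :
    orderOf θ = Nat.card 𝓀[F] ^ Module.finrank F L - 1 := by
  rw [orderOf_eq_card_of_forall_mem_zpowers hθ, Nat.card_units, hL.card_eq]

/-- If `n m = r` and `r b = N c`, then `N` divides `m b` if and only if `n` divides `c`. -/
lemma dvd_mul_iff_dvd {n m r N b c : ℤ} (hr : n * m = r) (hr0 : r ≠ 0) (hN : N ≠ 0)
    (h : r * b = N * c) : N ∣ m * b ↔ n ∣ c := by
  have hn : n ≠ 0 := left_ne_zero_of_mul (hr ▸ hr0)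
  have h1 : n * (m * b) = N * c := by rw [← mul_assoc, hr, h]
  rw [← mul_dvd_mul_iff_left hn, h1, mul_comm n N, mul_dvd_mul_iff_left hN]

/-- Orthogonality to `T_F` is translated into divisibility of exponents of `θ`. Necessity needs only
two families of test elements: Teichmüller points and points `x(ϖ)` with `x` invariant. -/
theorem mem_ZDagger_iff_of_representative
    (F L : Type u)
    [Field F] [ValuativeRel F] [TopologicalSpace F] [IsNonarchimedeanLocalField F]
    [Field L] [ValuativeRel L] [TopologicalSpace L] [IsNonarchimedeanLocalField L]
    [Algebra F L] [FiniteDimensional F L] [IsGalois F L] (hL : IsUnramified F L)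
    (Y : Type u) [AddCommGroup Y] [Module.Free ℤ Y] [Module.Finite ℤ Y]
    [DistribMulAction (L ≃ₐ[F] L) Y]
    (T' : CentralExtension Y F L) (Q : QuadraticForm ℤ Y) (hQ : T'.HasQuadraticForm Q)
    (n : ℕ) (hnq : n ∣ Nat.card 𝓀[F] - 1)
    (ϖ : Fˣ) (hϖ : ord F ϖ = Multiplicative.ofAdd 1)
    (γ : L ≃ₐ[F] L) (hγ : ∀ σ : L ≃ₐ[F] L, σ ∈ Subgroup.zpowers γ)
    (hγq : ∀ x : 𝒪[L], valuation L (γ (x : L) - (x : L) ^ Nat.card 𝓀[F]) < 1)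
    (θ : 𝓀[L]ˣ) (hθ : ∀ x : 𝓀[L]ˣ, x ∈ Subgroup.zpowers θ)
    (y₁ y₂ : Y) (t₁ : TL Y L) (ht₁ : t₁ ∈ TF1 F L Y) :
    cochar (Units.map (algebraMap F L : F →* L) ϖ) y₁ + cochar (teich θ) y₂ + t₁ ∈
        ZDagger T' n hnq ↔
      y₁ ∈ sharp Q n ⊤ ⊓ invariants (L ≃ₐ[F] L) Y ∧ y₂ ∈ sharp Q n ⊤ ∧
        ∃ w ∈ sharp Q n (invariants (L ≃ₐ[F] L) Y),
          (Nat.card 𝓀[F] : ℤ) • (γ • y₂) - y₂ =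
            ((Nat.card 𝓀[F] : ℤ) ^ Module.finrank F L - 1) • w := by
  set q := Nat.card 𝓀[F] with hq
  set d := Module.finrank F L with hd
  set ϖL := Units.map (algebraMap F L : F →* L) ϖ with hϖL
  have hϖ' : ord L ϖL = .ofAdd 1 := (hL.ord_eq ϖ).trans hϖ
  have hγϖ : Units.map ((γ : L →ₐ[F] L).toRingHom : L →* L) ϖL = ϖL :=
    Units.ext (γ.commutes (ϖ : F))
  have hγd : γ ^ d = 1 := by
    rw [hd, ← IsGalois.card_aut_eq_finrank F L]
    exact pow_card_eq_one'
  have hq1 : 1 < q := Finite.one_lt_card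
  have hd0 : d ≠ 0 := Module.finrank_pos.ne'
  set N : ℤ := (q : ℤ) ^ d - 1 with hN
  have hN0 : N ≠ 0 := by
    have : 1 < (q : ℤ) ^ d := one_lt_pow₀ (by exact_mod_cast hq1) hd0
    omega
  have hord : (orderOf θ : ℤ) = N := by
    rw [orderOf_eq_of_isUnramified hL hθ, Nat.cast_sub (Nat.one_le_pow _ _ (by omega))]
    push_cast
    rfl
  have hteich : teich θ ^ N = 1 := by
    rw [← hord, zpow_natCast, teich, ← map_pow, ← map_pow, pow_orderOf_eq_one, map_one, map_one]
  obtain ⟨m, hm⟩ := hnq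
  have hn0 : 0 < n := Nat.pos_of_ne_zero (by rintro rfl; omega)
  have hnm : (n : ℤ) * m = q - 1 := by
    rw [← Nat.cast_mul, ← hm, Nat.cast_sub hq1.le, Nat.cast_one]
  have hr0 : (q : ℤ) - 1 ≠ 0 := by omega
  have hQ' := hQ.1
  set B := QuadraticMap.polarBilin Q with hB
  have hBs (y y' : Y) : B y y' = B y' y := QuadraticMap.polar_comm Q y y'
  have hdvd {x y w : Y} (hx : x ∈ invariants (L ≃ₐ[F] L) Y)
      (h : (q : ℤ) • (γ • y) - y = N • w) : N ∣ m * B y x ↔ (n : ℤ) ∣ B w x :=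
    dvd_mul_iff_dvd hnm hr0 hN0 (sub_one_mul_polar hQ' (hx γ) h)
  -- The sign disappears after the `m`-th power once `n ∣ k`, because `n m = q - 1`.
  have hneg {k : ℤ} (hk : (n : ℤ) ∣ k) : ((-1 : 𝓀[L]ˣ) ^ k) ^ m = 1 := by
    obtain ⟨c, rfl⟩ := hk
    rw [← zpow_natCast, ← zpow_mul, mul_right_comm, ← Nat.cast_mul, ← hm, zpow_mul, zpow_natCast,
      neg_one_pow_card_sub_one hL, one_zpow]
  have hθk (k : ℤ) : (θ ^ k) ^ m = 1 ↔ N ∣ m * k := by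
    rw [← zpow_natCast, ← zpow_mul, ← orderOf_dvd_iff_zpow_eq_one, hord, mul_comm]
  set t := cochar ϖL y₁ + cochar (teich θ) y₂ + t₁ with ht
  have hvt : valMap t = y₁ := by
    rw [ht, map_add, map_add, valMap_uniformizer _ hϖ', valMap_teich, valMap_of_mem_TL1 ht₁.1,
      add_zero, add_zero]
  have hat : angMap hϖ' t = y₂ ⊗ₜ .ofMul θ := by
    rw [ht, map_add, map_add, angMap_uniformizer, angMap_teich, angMap_of_mem_TL1 hϖ' ht₁.1,
      zero_add, add_zero]
  have hpair {t' : TL Y L} {y' : Y} (ht' : angMap hϖ' t' = y' ⊗ₜ .ofMul θ) :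
      m • tamePairing B t t' = 0 ↔
        ((-1 : 𝓀[L]ˣ) ^ B y₁ (valMap t')) ^ m *
          (θ ^ (B y₂ (valMap t') - B y' y₁)) ^ m = 1 := by
    rw [tamePairing_eq_of_angMap hϖ' hBs hat ht', hvt, ← ofMul_pow, mul_pow]
    rfl
  rw [mem_ZDagger_iff hL T' Q hQ]
  have hdiv : (Nat.card 𝓀[F] - 1) / n = m := by
    rw [← hq, hm, Nat.mul_div_cancel_left m hn0]
  rw [hdiv]
  constructor
  · rintro ⟨htF, h⟩
    have hy₁ : y₁ ∈ invariants (L ≃ₐ[F] L) Y :=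
      hvt ▸ valMap_mem_invariants hγ hγq hϖ' hγϖ htF
    obtain ⟨w, hw⟩ := exists_of_angMap_eq hγ hγq hϖ' hγϖ htF hat
    rw [hord] at hw
    have hy₁' : y₁ ∈ sharp Q n ⊤ := by
      intro w' _
      have hw' := smul_twistedNorm (q := (q : ℤ)) hγd w'
      -- The test element is `y'(teich θ)` with `y'` the twisted norm of an arbitrary `w'`. Its
      -- valuation is zero, so no sign occurs.
      have h1 := (hpair (angMap_teich hϖ' _ θ)).1
        (h _ (cochar_teich_mem_TF hγ hγq hteich hw'))
      rw [valMap_teich, map_zero, map_zero, zpow_zero, one_pow, one_mul, zero_sub, hθk, mul_neg,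
        dvd_neg, hdvd hy₁ hw', hBs] at h1
      exact h1
    have hw' : w ∈ sharp Q n (invariants (L ≃ₐ[F] L) Y) := by
      intro x hx
      -- The test element is `x(ϖ)`, with trivial angular component. The sign `(-1)^B(y₁, x)` is
      -- removed by `hy₁'`, which therefore has to come first.
      have h1 := (hpair (y' := 0) ((angMap_uniformizer hϖ' x).trans
        (TensorProduct.zero_tmul _ _).symm)).1 (h _ (cochar_uniformizer_mem_TF hγ hγϖ hx))
      rw [valMap_uniformizer _ hϖ', hneg (k := B y₁ x) (hy₁' x trivial), one_mul, map_zero,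
        LinearMap.zero_apply, sub_zero, hθk, hdvd hx hw] at h1
      exact h1
    refine ⟨⟨hy₁', hy₁⟩, ?_, w, hw', hw⟩
    rw [eq_twistedNorm hγd hN0 hw]
    exact twistedNorm_mem_sharp hQ' hγ hγd ⟨m, hnm.symm⟩ hw'
  · rintro ⟨⟨hy₁', hy₁⟩, -, w, hw', hw⟩
    refine ⟨add_mem (add_mem (cochar_uniformizer_mem_TF hγ hγϖ hy₁)
      (cochar_teich_mem_TF hγ hγq hteich hw)) ht₁.2, fun t' ht' => ?_⟩
    obtain ⟨y', hy'⟩ := exists_tmul_eq_of_forall_mem_zpowers hθ (angMap hϖ' t')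
    obtain ⟨w', hw''⟩ := exists_of_angMap_eq hγ hγq hϖ' hγϖ ht' hy'
    rw [hord] at hw''
    have hv := valMap_mem_invariants hγ hγq hϖ' hγϖ ht'
    rw [hpair hy', hneg (k := B y₁ (valMap t')) (hy₁' _ trivial), one_mul, hθk, mul_sub]
    -- The exponent splits: the term in `y₂` is controlled by `w ∈ Y^{Γ#}` against the invariant
    -- valuation of `t'`, the term in `y'` by `y₁ ∈ Y^#` against `w'`.
    refine dvd_sub ((hdvd hv hw).2 (hw' _ hv)) ((hdvd hy₁ hw'').2 ?_)
    rw [hBs]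
    exact hy₁' _ trivial

end MetaplecticTorus

theorem mainTheorem4
    -- `L / F` is a finite unramified Galois extension of nonarchimedean local fields
    (F L : Type u)
    [Field F] [ValuativeRel F] [TopologicalSpace F] [IsNonarchimedeanLocalField F]
    [Field L] [ValuativeRel L] [TopologicalSpace L] [IsNonarchimedeanLocalField L]
    [Algebra F L] [FiniteDimensional F L] [IsGalois F L] (hL : IsUnramified F L)
    -- the cocharacter lattice of a torus over `F` that splits over `L`
    (Y : Type u) [AddCommGroup Y] [Module.Free ℤ Y] [Module.Finite ℤ Y]
    [DistribMulAction (L ≃ₐ[F] L) Y]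
    -- a central extension of the torus by `K₂`, with its quadratic form
    (T' : CentralExtension Y F L) (Q : QuadraticForm ℤ Y) (hQ : T'.HasQuadraticForm Q)
    -- `F` has enough `n`-th roots of unity, and `n` is prime to the residue characteristic
    (n : ℕ) (hn : 0 < n) (hroots : Nat.card (rootsOfUnity n F) = n)
    (hp : (ringChar 𝓀[F]).Coprime n)
    -- a uniformizer of `F`
    (ϖ : Fˣ) (hϖ : ord F ϖ = Multiplicative.ofAdd 1)
    -- the generator of the Galois group that acts on the residue field of `L` by `x ↦ x ^ q`
    (γ : L ≃ₐ[F] L) (hγ : ∀ σ : L ≃ₐ[F] L, σ ∈ Subgroup.zpowers γ)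
    (hγq : ∀ x : 𝒪[L], valuation L (γ (x : L) - (x : L) ^ Nat.card 𝓀[F]) < 1)
    -- a generator of the multiplicative group of the residue field of `L`
    (θ : 𝓀[L]ˣ) (hθ : ∀ x : 𝓀[L]ˣ, x ∈ Subgroup.zpowers θ)
    (y₁ : Y) (ybar₂ : Ybar Y (Nat.card 𝓀[F] ^ Module.finrank F L - 1))
    (t₁ : TL Y L) (ht₁ : t₁ ∈ TF1 F L Y) :
    (cochar (Units.map (algebraMap F L : F →* L) ϖ) y₁ +
          cocharBar (teich θ) _ (teich_pow hL θ) ybar₂ + t₁ ∈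
        ZDagger T' n (dvd_card_sub_one hroots hn hp) ↔
      y₁ ∈ sharp Q n ⊤ ⊓ invariants (L ≃ₐ[F] L) Y ∧
      (∀ y₂ : Y, QuotientAddGroup.mk y₂ = ybar₂ → y₂ ∈ sharp Q n ⊤) ∧
      (∀ y₂ : Y, QuotientAddGroup.mk y₂ = ybar₂ →
        ∃ w ∈ sharp Q n (invariants (L ≃ₐ[F] L) Y),
          (Nat.card 𝓀[F] : ℤ) • (γ • y₂) - y₂ =
            ((Nat.card 𝓀[F] : ℤ) ^ Module.finrank F L - 1) • w)) ∧
    -- the criterion may be tested on any single representative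
    (∀ y₂ : Y, QuotientAddGroup.mk y₂ = ybar₂ →
      (cochar (Units.map (algebraMap F L : F →* L) ϖ) y₁ +
            cocharBar (teich θ) _ (teich_pow hL θ) ybar₂ + t₁ ∈
          ZDagger T' n (dvd_card_sub_one hroots hn hp) ↔
        y₁ ∈ sharp Q n ⊤ ⊓ invariants (L ≃ₐ[F] L) Y ∧
        y₂ ∈ sharp Q n ⊤ ∧
        ∃ w ∈ sharp Q n (invariants (L ≃ₐ[F] L) Y),
          (Nat.card 𝓀[F] : ℤ) • (γ • y₂) - y₂ =
            ((Nat.card 𝓀[F] : ℤ) ^ Module.finrank F L - 1) • w)) := by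
  have key := mem_ZDagger_iff_of_representative F L hL Y T' Q hQ n (dvd_card_sub_one hroots hn hp)
    ϖ hϖ γ hγ hγq θ hθ y₁
  refine ⟨?_, ?_⟩
  · obtain ⟨y₂, rfl⟩ := QuotientAddGroup.mk_surjective ybar₂
    constructor
    · intro h
      refine ⟨((key y₂ t₁ ht₁).1 h).1, fun y hy => ?_, fun y hy => ?_⟩
      -- The element of `T_L` depends only on the class of `y₂`, so the criterion for one
      -- representative applies to every other.
      · rw [← hy] at h
        exact ((key y t₁ ht₁).1 h).2.1
      · rw [← hy] at h
        exact ((key y t₁ ht₁).1 h).2.2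
    · rintro ⟨h₁, h₂, h₃⟩
      exact (key y₂ t₁ ht₁).2 ⟨h₁, h₂ y₂ rfl, h₃ y₂ rfl⟩
  · rintro y₂ rfl
    exact key y₂ t₁ ht₁
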